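/- For integers $d\ge 1$, $g\ge 0$ let $m_g(d)$ be the one-part monotone Hurwitz number: $\frac{1}{(d-1)!}$ times the number of sequences of transpositions $\big((a_1\,b_1),\dots,(a_r\,b_r)\big)$ of $\{1,\dots,d\}$, with $r=d+2g-1$ and $a_i<b_i$, such that $b_1\le b_2\le\dots\le b_r$ and the product $(a_1\,b_1)\cdots(a_r\,b_r)$ is a long cycle (a cycle of length $d$). Put $E(n,g)=m_g(n+1)$. Let $\theta(\lambda)=-1+\dfrac{\operatorname{Artanh}\sqrt{1-4\lambda}}{\sqrt{1-4\lambda}}$ for $0<\lambda<\frac14$ and $\theta(\tfrac14)=0$. This is a bijection from $(0,\frac14]$ onto $[0,\infty)$; let $\lambda=\lambda(\theta)$ be its inverse. For $\theta>0$ we have $1-4(\theta+1)\lambda(\theta)>0$, and we put $$f(\theta)=-\ln\lambda(\theta)-2\theta-\theta\ln\big(1-4\lambda(\theta)\big),\qquad j(\theta)=-\tfrac12\ln\big(1-4(\theta+1)\lambda(\theta)\big)+\ln 2 .$$ Let $$\Omega(n,g)=\frac{\sqrt g\,g^g}{\sqrt{2\pi}\,e^g\,g!}\;n^{2g-2}\exp\Big(n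 f\big(\tfrac gn\big)+j\big(\tfrac gn\big)\Big)\quad(g\ge1),\qquad \Omega(n,0)=\frac{4^n n^{-3/2}}{\sqrt{\pi}},$$ where the value at $g=0$ is the limit of the general expression as the real variable $g$ tends to $0$ (with $g!=\Gamma(g+1)$). Then for every sequence $g=g_n$ of nonnegative integers, $$E(n,g_n)\sim\Omega(n,g_n)\qquad(n\to\infty);$$ moreover $E(n,g)/\Omega(n,g)\to1$ as $n\to\infty$, uniformly in $g\ge0$. -/

import Mathlib

open Filter Set Asymptotics

noncomputable section

namespace MonotoneHurwitz

/-- The monotone factorisations of length `r` of long cycles of the symmetric group on `Fin d`.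
The `i`-th factor is the transposition exchanging `(τ i).1 < (τ i).2`; the larger entries are
weakly increasing along the product, and the product is a long cycle, that is, a permutation with
a single orbit. -/
def monotoneFactorisations (d r : ℕ) : Set (Fin r → Fin d × Fin d) :=
  {τ | (∀ i, (τ i).1 < (τ i).2) ∧
    (∀ i k, i ≤ k → (τ i).2 ≤ (τ k).2) ∧
    Equiv.Perm.IsCycleOn (List.ofFn fun i => Equiv.swap (τ i).1 (τ i).2).prod Set.univ}

/-- The one part monotone Hurwitz number `m_g(d)`, for `1 ≤ d`: the number of monotone
factorisations of the `(d - 1)!` long cycles into `d + 2 g - 1` transpositions, divided by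
`(d - 1)!`. -/
def m (g d : ℕ) : ℝ :=
  ((monotoneFactorisations d (d + 2 * g - 1)).ncard : ℝ) / ((d - 1).factorial : ℝ)

/-- `E(n, g) = m_g(n + 1)`. -/
def E (n g : ℕ) : ℝ := m g (n + 1)

/-- `θ(x) = -1 + Artanh(√(1 - 4x)) / √(1 - 4x)` for `0 < x < 1/4`, extended by its limit
`θ(1/4) = 0`. -/
def theta (x : ℝ) : ℝ :=
  if x = 1 / 4 then 0 else -1 + Real.artanh (√(1 - 4 * x)) / √(1 - 4 * x)

/-- The inverse function `λ : [0, ∞) → (0, 1/4]` of `θ : (0, 1/4] → [0, ∞)`. -/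
def lam (t : ℝ) : ℝ := Function.invFunOn theta (Set.Ioc 0 (1 / 4)) t

/-- `f = -ln λ - 2θ - θ ln(1 - 4λ)`. -/
def f (t : ℝ) : ℝ :=
  -Real.log (lam t) - 2 * t - t * Real.log (1 - 4 * lam t)

/-- `j = -ln(1 - 4(θ + 1)λ) / 2 + ln 2`. -/
def j (t : ℝ) : ℝ :=
  -Real.log (1 - 4 * (t + 1) * lam t) / 2 + Real.log 2

/-- The asymptotic form. At `g = 0`, where `j(g/n)` is infinite and `√g` vanishes, the value is
the limit `4 ^ n * n ^ (-3/2) / √π` of the general expression as the real variable `g` tends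
to `0`. -/
def Omega (n g : ℕ) : ℝ :=
  if g = 0 then (4 : ℝ) ^ n * (n : ℝ) ^ (-(3 / 2) : ℝ) / √Real.pi
  else √(g : ℝ) * (g : ℝ) ^ g / (√(2 * Real.pi) * Real.exp (g : ℝ) * (g.factorial : ℝ)) *
    (n : ℝ) ^ (2 * (g : ℤ) - 2) *
    Real.exp ((n : ℝ) * f ((g : ℝ) / (n : ℝ)) + j ((g : ℝ) / (n : ℝ)))

end MonotoneHurwitz

end

/-! The proof has an exact part and an analytic part.

Exact part: `E n g` is the Catalan number of `n` times `centralFactorial n g`, the complete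
homogeneous symmetric polynomial of degree `g` in `1 ^ 2, …, n ^ 2` (`E_eq`). A sum over monotone
sequences is a complete homogeneous polynomial in the Jucys-Murphy elements, so it suffices to
expand the indicator of the long cycles in joint eigenfunctions of these elements. On the sum-zero
hyperplane `det (1 - σ)` is `n + 1` for a long cycle and `0` otherwise, and it is the alternating
sum of the principal minors of `σ`. In the Helmert basis, which is the Gelfand-Tsetlin basis of the
standard representation, these minors are diagonal coefficients of the exterior powers (the hook
representations), hence eigenfunctions, with the contents of a hook as eigenvalues. The generating
functions of the hooks are summed by a Vandermonde identity.

Analytic part: up to explicit factors, `centralFactorial n g` is the coefficient of `z ^ (2 (n +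
g))` in `(2 sinh z) ^ (2 n)`. Euler's product makes `sinh w / w` on a circle of radius `u`, divided
by its value at `u`, the characteristic function of a sum of independent Bernoulli variables. If `n
(u coth u - 1) = g`, the mean for the power `2 n` is `g`, and a local limit theorem gives the
coefficient with relative error `O(1 / √g)`, because the variance is at least `g / 2`. The
substitution `λ = 1 / (4 cosh² u)` turns `θ` into `u coth u - 1`, and Stirling's formula identifies
the main term with `Omega`. This settles `n` and `g` both large.

For fixed `g` elementary bounds give `centralFactorial n g ~ n ^ (3 g) / (3 ^ g g!)`, and `Omega` is
expanded as `u → 0`. Only finitely many `g` are left over by the first regime, so the convergence is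
uniform. -/

noncomputable section

namespace MonotoneHurwitz

/-! ### Rank-one updates of a determinant -/

open Matrix in
-- The adjugate form is needed because the minors to which it is applied may be singular. For
-- invertible matrices it is the matrix determinant lemma; both sides are continuous and `A + t • 1`
-- is invertible for all small `t ≠ 0`.
theorem det_sub_vecMulVec {n : Type*} [Fintype n] [DecidableEq n] (A : Matrix n n ℝ)
    (u v : n → ℝ) :
    (A - vecMulVec u v).det = A.det - v ⬝ᵥ (A.adjugate *ᵥ u) := by
  have key : ∀ B : Matrix n n ℝ, B.det ≠ 0 →
      (B - vecMulVec u v).det = B.det - v ⬝ᵥ (B.adjugate *ᵥ u) := by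
    intro B hB
    have h := det_add_replicateCol_mul_replicateRow (ι := Unit) (isUnit_iff_ne_zero.mpr hB) (-u) v
    rw [← vecMulVec_eq, neg_vecMulVec, ← sub_eq_add_neg] at h
    have h1 : (1 + replicateRow Unit v * B⁻¹ * replicateCol Unit (-u)).det =
        1 - B.det⁻¹ * (v ⬝ᵥ (B.adjugate *ᵥ u)) := by
      have h2 : replicateRow Unit v * B⁻¹ * replicateCol Unit (-u) =
          of fun _ _ => v ⬝ᵥ (B⁻¹ *ᵥ (-u)) := by
        rw [Matrix.mul_assoc, ← replicateCol_mulVec, replicateRow_mul_replicateCol]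
      rw [h2, det_unique (n := Unit), Matrix.add_apply, one_apply_eq, of_apply, mulVec_neg,
        dotProduct_neg, inv_def, Ring.inverse_eq_inv', smul_mulVec, dotProduct_smul, smul_eq_mul,
        sub_eq_add_neg]
    rw [h, h1]
    field_simp
  have hcont : Continuous fun t : ℝ => A + t • (1 : Matrix n n ℝ) := by fun_prop
  have h1 : Continuous fun t : ℝ => ((A + t • (1 : Matrix n n ℝ)) - vecMulVec u v).det :=
    (hcont.sub continuous_const).matrix_det
  have h2 : Continuous fun t : ℝ => (A + t • (1 : Matrix n n ℝ)).det -
      v ⬝ᵥ ((A + t • (1 : Matrix n n ℝ)).adjugate *ᵥ u) :=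
    hcont.matrix_det.sub (continuous_const.dotProduct (hcont.matrix_adjugate.matrix_mulVec
      continuous_const))
  have hne : ∀ᶠ t in nhdsWithin (0 : ℝ) {0}ᶜ, (A + t • (1 : Matrix n n ℝ)).det ≠ 0 := by
    have hp : ((-A).charpoly) ≠ 0 := (charpoly_monic _).ne_zero
    have hfin : ((-A).charpoly.roots.toFinset : Set ℝ).Finite := Finset.finite_toSet _
    have hev : ∀ᶠ t in nhdsWithin (0 : ℝ) {0}ᶜ,
        t ∉ ((-A).charpoly.roots.toFinset : Set ℝ) \ {0} := by
      have hcl : IsClosed (((-A).charpoly.roots.toFinset : Set ℝ) \ {0}) :=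
        (hfin.subset sdiff_subset).isClosed
      exact mem_nhdsWithin_of_mem_nhds (hcl.isOpen_compl.mem_nhds (by simp))
    filter_upwards [hev, self_mem_nhdsWithin] with t ht ht0 h0
    apply ht
    refine ⟨?_, ht0⟩
    simp only [Finset.mem_coe, Multiset.mem_toFinset, Polynomial.mem_roots hp, Polynomial.IsRoot,
      eval_charpoly]
    rw [← h0]
    congr 1
    rw [sub_neg_eq_add, add_comm]
    congr 1
    ext i j
    simp [Matrix.scalar_apply, Matrix.diagonal_apply, Matrix.one_apply]
  have := tendsto_nhds_unique_of_eventuallyEq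
    (h1.continuousAt.tendsto.mono_left (nhdsWithin_le_nhds (s := {0}ᶜ) (a := 0)))
    (h2.continuousAt.tendsto.mono_left (nhdsWithin_le_nhds (s := {0}ᶜ) (a := 0)))
    (by filter_upwards [hne] with t ht using key _ ht)
  simpa using this

/-! ### The Helmert basis and the Laplacians of stars -/

/-- The vectors `j e_j - ∑_{a < j} e_a`, for `1 ≤ j` an orthogonal basis of the sum-zero
hyperplane. -/
def helmert (j a : ℕ) : ℝ := if a = j then j else if a < j then -1 else 0

theorem sum_mul_helmert {d : ℕ} (j : Fin d) (G : Fin d → ℝ) :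
    ∑ x : Fin d, G x * helmert j x = j * G j - ∑ x with x < j, G x := by
  rw [Finset.sum_filter, ← Finset.add_sum_erase _ _ (Finset.mem_univ j),
    ← Finset.add_sum_erase _ (fun x => if x < j then G x else 0) (Finset.mem_univ j)]
  simp only [helmert, if_true, lt_irrefl, if_false, zero_add]
  rw [mul_comm, sub_eq_add_neg, ← Finset.sum_neg_distrib]
  congr 1
  refine Finset.sum_congr rfl fun x hx => ?_
  have hne : (x : ℕ) ≠ j := fun h => (Finset.ne_of_mem_erase hx) (Fin.ext h)
  by_cases h : x < j
  · have : (x : ℕ) < j := h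
    simp [hne, this, h]
  · have : ¬ (x : ℕ) < j := h
    simp [hne, this, h]

theorem sum_filter_lt_const {d : ℕ} (j : Fin d) (c : ℝ) : ∑ x with x < j, c = j * c := by
  rw [Finset.sum_const, nsmul_eq_mul]
  congr 2
  have : (Finset.univ.filter fun x : Fin d => x < j) = Finset.Iio j := by ext; simp
  rw [this, Fin.card_Iio]

theorem sum_helmert {d : ℕ} (j : Fin d) : ∑ x : Fin d, helmert j x = 0 := by
  have := sum_mul_helmert j (fun _ => 1)
  rw [sum_filter_lt_const j 1] at this
  simpa only [one_mul, mul_one, sub_self] using this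

theorem sum_helmert_mul_helmert_of_lt {d : ℕ} {i j : Fin d} (hij : i < j) :
    ∑ x : Fin d, helmert j x * helmert i x = 0 := by
  have h0 : (i : ℕ) < j := hij
  rw [sum_mul_helmert i (fun x => helmert j x)]
  have : ∑ x with x < i, helmert j x = ∑ x : Fin d with x < i, (-1 : ℝ) := by
    refine Finset.sum_congr rfl fun x hx => ?_
    have hx : (x : ℕ) < i := (Finset.mem_filter.mp hx).2
    simp [helmert, (hx.trans h0).ne, hx.trans h0]
  rw [this, sum_filter_lt_const]
  simp [helmert, h0.ne, h0]

theorem sum_helmert_mul_helmert {d : ℕ} (i j : Fin d) :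
    ∑ x : Fin d, helmert i x * helmert j x = if i = j then (i : ℝ) * (i + 1) else 0 := by
  rcases lt_trichotomy i j with h | h | h
  · rw [if_neg h.ne, ← sum_helmert_mul_helmert_of_lt h]
    exact Finset.sum_congr rfl fun x _ => mul_comm _ _
  · subst h
    rw [if_pos rfl, sum_mul_helmert i (fun x => helmert i x)]
    have : ∑ x with x < i, helmert i x = ∑ x : Fin d with x < i, (-1 : ℝ) := by
      refine Finset.sum_congr rfl fun x hx => ?_
      have hx : (x : ℕ) < i := (Finset.mem_filter.mp hx).2
      simp [helmert, hx.ne, hx]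
    rw [this, sum_filter_lt_const]
    simp [helmert]
    ring
  · rw [if_neg h.ne', sum_helmert_mul_helmert_of_lt h]

/-- The eigenvalue on `helmert j` of the Laplacian of the star with centre `b` and leaves
`a < b`. -/
def starEigenvalue (b j : ℕ) : ℝ := if b < j then 0 else if j = b then b + 1 else 1

/-- All star Laplacians are diagonal in the same basis. For `b < j` the vector is constant on the
star; for `j < b` it vanishes at `b`, is supported on the leaves and has sum zero; for `j = b` it is
the radial eigenvector of the star. -/
theorem sum_star_helmert {d : ℕ} (b j : Fin d) (F : Fin d → ℝ) :
    ∑ a with a < b, (F a - F b) * (helmert j a - helmert j b) =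
      starEigenvalue b j * ∑ x : Fin d, F x * helmert j x := by
  rcases lt_trichotomy b j with h | h | h
  · have h0 : (b : ℕ) < j := h
    rw [starEigenvalue, if_pos h0, zero_mul]
    refine Finset.sum_eq_zero fun x hx => ?_
    have hx : (x : ℕ) < b := (Finset.mem_filter.mp hx).2
    simp [helmert, h0.ne, h0, (hx.trans h0).ne, hx.trans h0]
  · subst h
    rw [starEigenvalue, if_neg (lt_irrefl _), if_pos rfl, sum_mul_helmert b F]
    have : ∑ a with a < b, (F a - F b) * (helmert b a - helmert b b) =
        ∑ a with a < b, (-(b + 1 : ℝ) * F a + (b + 1) * F b) := by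
      refine Finset.sum_congr rfl fun x hx => ?_
      have hx : (x : ℕ) < b := (Finset.mem_filter.mp hx).2
      simp [helmert, hx.ne, hx]
      ring
    rw [this, Finset.sum_add_distrib, ← Finset.mul_sum, sum_filter_lt_const]
    ring
  · have h0 : (j : ℕ) < b := h
    rw [starEigenvalue, if_neg h0.not_gt, if_neg h0.ne, one_mul]
    have h1 : ∀ G : Fin d → ℝ, ∑ a with a < b, G a * helmert j a = ∑ a, G a * helmert j a := by
      intro G
      rw [Finset.sum_filter]
      refine Finset.sum_congr rfl fun x _ => ?_
      split_ifs with hx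
      · rfl
      · have hx : (j : ℕ) < x := h0.trans_le (not_lt.mp hx)
        simp [helmert, hx.ne', hx.not_gt]
    have h2 : helmert j b = 0 := by simp [helmert, h0.ne', h0.not_gt]
    have h3 : ∑ a with a < b, F b * helmert j a = 0 := by
      rw [h1 fun _ => F b, ← Finset.mul_sum, sum_helmert, mul_zero]
    have h4 : ∑ a with a < b, (F a - F b) * (helmert j a - helmert j b) =
        ∑ a with a < b, F a * helmert j a - ∑ a with a < b, F b * helmert j a := by
      rw [← Finset.sum_sub_distrib]
      exact Finset.sum_congr rfl fun x _ => by rw [h2]; ring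
    rw [h4, h3, h1, sub_zero]

/-! ### Principal minors as eigenfunctions of the Jucys-Murphy elements -/

section

open Equiv

/-- The matrix coefficients of `σ` in the basis `helmert 1, …, helmert n`. -/
def gram {n : ℕ} (σ : Perm (Fin (n + 1))) : Matrix (Fin n) (Fin n) ℝ :=
  Matrix.of fun i j => ∑ x, helmert i.succ (σ x) * helmert j.succ x

/-- The squared norm of `helmert (i + 1)`. -/
def helmertSq {n : ℕ} (i : Fin n) : ℝ := (i + 1) * (i + 2)

/-- The determinant whose rows in `S` are those of `gram σ` and whose other rows are those of
`gram 1`: up to normalisation a principal minor. -/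
def gramMatrix {n : ℕ} (S : Finset (Fin n)) (σ : Perm (Fin (n + 1))) : Matrix (Fin n) (Fin n) ℝ :=
  Matrix.of fun i => if i ∈ S then gram σ i else Pi.single i (helmertSq i)

theorem gram_one {n : ℕ} : gram (1 : Perm (Fin (n + 1))) = Matrix.diagonal helmertSq := by
  ext i j
  rw [gram, Matrix.of_apply, Matrix.diagonal_apply]
  simp only [Perm.one_apply]
  rw [sum_helmert_mul_helmert]
  simp only [Fin.succ_inj, helmertSq, Fin.val_succ]
  split_ifs
  · push_cast; ring
  · rfl

theorem gramMatrix_one {n : ℕ} (S : Finset (Fin n)) :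
    gramMatrix S 1 = Matrix.diagonal helmertSq := by
  ext i j
  rw [gramMatrix, Matrix.of_apply, gram_one]
  split_ifs
  · rfl
  · rw [Matrix.diagonal_apply, Pi.single_apply]
    simp only [eq_comm]

/-- A transposition differs from the identity by a reflection of rank one, which is what makes
`det_sub_vecMulVec` applicable. -/
theorem gram_mul_swap {n : ℕ} (σ : Perm (Fin (n + 1))) {a b : Fin (n + 1)} (hab : a ≠ b)
    (i j : Fin n) :
    gram (σ * swap a b) i j = gram σ i j - (helmert i.succ (σ a) - helmert i.succ (σ b)) *
      (helmert j.succ a - helmert j.succ b) := by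
  simp only [gram, Matrix.of_apply, Perm.mul_apply]
  rw [← Equiv.sum_comp (swap a b)]
  simp only [swap_apply_self]
  have : ∀ x, helmert i.succ (σ x) * helmert j.succ (swap a b x) =
      helmert i.succ (σ x) * helmert j.succ x -
      ((if x = a then helmert i.succ (σ x) * (helmert j.succ a - helmert j.succ b) else 0) +
        if x = b then helmert i.succ (σ x) * (helmert j.succ b - helmert j.succ a) else 0) := by
    intro x
    by_cases hxa : x = a
    · subst hxa
      simp [hab]
      ring
    · by_cases hxb : x = b
      · subst hxb
        simp [hxa]
        ring
      · simp [hxa, hxb, swap_apply_of_ne_of_ne hxa hxb]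
  rw [Finset.sum_congr rfl fun x _ => this x, Finset.sum_sub_distrib, Finset.sum_add_distrib]
  simp only [Finset.sum_ite_eq', Finset.mem_univ, if_true]
  ring

/-- The eigenvalue of the `b`-th Jucys-Murphy element on `fun σ ↦ (gramMatrix S σ).det`. -/
def content {n : ℕ} (S : Finset (Fin n)) (b : ℕ) : ℝ :=
  b - ∑ j ∈ S, starEigenvalue b (j + 1)

open Matrix in
-- Each transposition changes the determinant by a bilinear expression in the adjugate. Summed over
-- the leaves of the star at `b`, these expressions form a star Laplacian, and the cofactor
-- expansions reduce the result to a multiple of the original determinant.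
theorem sum_det_gramMatrix_mul_swap {n : ℕ} (S : Finset (Fin n)) (σ : Perm (Fin (n + 1)))
    (b : Fin (n + 1)) :
    ∑ a with a < b, (gramMatrix S (σ * swap a b)).det = content S b * (gramMatrix S σ).det := by
  set W := gramMatrix S σ with hW
  set u : Fin (n + 1) → Fin n → ℝ := fun a i =>
    if i ∈ S then helmert i.succ (σ a) - helmert i.succ (σ b) else 0 with hu
  set v : Fin (n + 1) → Fin n → ℝ := fun a j => helmert j.succ a - helmert j.succ b with hv
  have h1 : ∀ a ∈ Finset.univ.filter (· < b), (gramMatrix S (σ * swap a b)).det =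
      W.det - v a ⬝ᵥ (W.adjugate *ᵥ u a) := by
    intro a ha
    rw [← det_sub_vecMulVec]
    congr 1
    ext i j
    rw [Matrix.sub_apply, vecMulVec_apply, hW, gramMatrix, gramMatrix, of_apply, of_apply, hu]
    by_cases hi : i ∈ S
    · simp only [hi, if_true, hv]
      exact gram_mul_swap σ (Finset.mem_filter.mp ha).2.ne i j
    · simp [hi]
  rw [Finset.sum_congr rfl h1, Finset.sum_sub_distrib, sum_filter_lt_const]
  have hdiag : ∀ j, ∑ i, W.adjugate j i * W i j = W.det := by
    intro j
    have := congrFun (congrFun (adjugate_mul W) j) j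
    simpa [mul_apply] using this
  have hoff : ∀ j ∉ S, W.adjugate j j * W j j = W.det := by
    intro j hj
    have := congrFun (congrFun (mul_adjugate W) j) j
    rw [mul_apply] at this
    have hrow : ∀ k, W j k = if k = j then helmertSq j else 0 := by
      intro k
      rw [hW, gramMatrix, of_apply, if_neg hj, Pi.single_apply]
    rw [Finset.sum_eq_single j (fun k _ hk => by rw [hrow, if_neg hk, zero_mul]) (by simp)] at this
    rw [mul_comm, this]
    simp
  -- For each column `j` the sum over `a` is a star form paired with a Helmert vector, so
  -- `sum_star_helmert` returns the entry `W i j` times an eigenvalue.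
  have h2 : ∑ a with a < b, v a ⬝ᵥ (W.adjugate *ᵥ u a) =
      ∑ j, starEigenvalue b j.succ * ∑ i ∈ S, W.adjugate j i * W i j := by
    simp only [dotProduct, mulVec]
    rw [Finset.sum_comm]
    refine Finset.sum_congr rfl fun j _ => ?_
    simp only [Finset.mul_sum]
    rw [Finset.sum_comm, ← Finset.sum_subset (Finset.subset_univ S)]
    · refine Finset.sum_congr rfl fun i hi => ?_
      have h3 := sum_star_helmert b j.succ (fun x => helmert i.succ (σ x))
      have h4 : W i j = ∑ x, helmert i.succ (σ x) * helmert j.succ x := by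
        rw [hW, gramMatrix, of_apply, if_pos hi, gram, of_apply]
      rw [h4, mul_left_comm, ← h3, Finset.mul_sum]
      refine Finset.sum_congr rfl fun a _ => ?_
      simp only [hu, hv, hi, if_true]
      ring
    · intro i _ hi
      simp [hu, hi]
  -- The sum over all rows is `W.det`. Rows outside `S` are multiples of unit vectors, so they carry
  -- all of it when `j ∉ S` and nothing when `j ∈ S`.
  have h5 : ∀ j, ∑ i ∈ S, W.adjugate j i * W i j = if j ∈ S then W.det else 0 := by
    intro j
    have hcompl : ∑ i ∈ Sᶜ, W.adjugate j i * W i j = if j ∈ S then 0 else W.det := by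
      have hrow : ∀ i ∈ Sᶜ, W.adjugate j i * W i j =
          if i = j then W.adjugate j j * W j j else 0 := by
        intro i hi
        split_ifs with hij
        · rw [hij]
        · rw [hW, gramMatrix, of_apply, if_neg (Finset.mem_compl.mp hi), Pi.single_apply,
            if_neg (Ne.symm hij), mul_zero]
      rw [Finset.sum_congr rfl hrow, Finset.sum_ite_eq']
      by_cases hj : j ∈ S
      · simp [hj]
      · simp [hj, hoff j hj]
    have := Finset.sum_add_sum_compl S fun i => W.adjugate j i * W i j
    rw [hdiag, hcompl] at this
    split_ifs at this ⊢ <;> linarith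
  rw [h2, Finset.sum_congr rfl fun j _ => by rw [h5], content, sub_mul, Finset.sum_mul]
  congr 1
  simp only [mul_ite, mul_zero, Finset.sum_ite_mem, Finset.univ_inter, Fin.val_succ]

/-- Orthogonality to the trivial representation: translation invariance gives the sum over the group
the eigenvalue `i + 1` under the Jucys-Murphy element of index `i + 1`, whereas for `i ∈ S` the
content is strictly smaller. -/
theorem sum_gramMatrix_det_univ {n : ℕ} (S : Finset (Fin n)) :
    ∑ σ : Perm (Fin (n + 1)), (gramMatrix S σ).det =
      if S = ∅ then ((n + 1).factorial : ℝ) * ∏ i : Fin n, helmertSq i else 0 := by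
  split_ifs with hS
  · subst hS
    have : ∀ σ : Perm (Fin (n + 1)), (gramMatrix ∅ σ).det = ∏ i : Fin n, helmertSq i := by
      intro σ
      rw [← Matrix.det_diagonal]
      congr 1
      ext i j
      simp [gramMatrix, Matrix.diagonal_apply, Pi.single_apply, eq_comm]
    rw [Finset.sum_congr rfl fun σ _ => this σ, Finset.sum_const, Finset.card_univ,
      Fintype.card_perm, Fintype.card_fin, nsmul_eq_mul]
  · obtain ⟨i, hi⟩ := Finset.nonempty_iff_ne_empty.mpr hS
    have h1 : ∑ σ : Perm (Fin (n + 1)), ∑ a with a < i.succ,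
        (gramMatrix S (σ * swap a i.succ)).det =
        i.succ * ∑ σ : Perm (Fin (n + 1)), (gramMatrix S σ).det := by
      rw [Finset.sum_comm, ← sum_filter_lt_const]
      refine Finset.sum_congr rfl fun a _ => ?_
      exact Equiv.sum_comp (Equiv.mulRight (swap a i.succ)) fun σ => (gramMatrix S σ).det
    rw [Finset.sum_congr rfl fun σ _ => sum_det_gramMatrix_mul_swap S σ i.succ,
      ← Finset.mul_sum] at h1
    have h2 : content S i.succ < i.succ := by
      rw [content, sub_lt_self_iff]
      refine Finset.sum_pos' (fun j _ => ?_) ⟨i, hi, ?_⟩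
      · unfold starEigenvalue
        split_ifs <;> positivity
      · simp only [starEigenvalue, Fin.val_succ, lt_irrefl, if_false, if_true]
        positivity
    have h3 : (content S i.succ - i.succ) *
        ∑ σ : Perm (Fin (n + 1)), (gramMatrix S σ).det = 0 := by
      rw [sub_mul, h1, sub_self]
    exact (mul_eq_zero.mp h3).resolve_left (sub_ne_zero.mpr h2.ne)

/-- Multilinearity of the determinant in the rows; it is the expansion of the characteristic
polynomial at `1` in principal minors. -/
theorem sum_neg_one_pow_mul_det_gramMatrix {n : ℕ} (σ : Perm (Fin (n + 1))) :
    ∑ S : Finset (Fin n), (-1) ^ S.card * (gramMatrix S σ).det =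
      (Matrix.diagonal helmertSq - gram σ).det := by
  have h := (Matrix.detRowAlternating (n := Fin n) (R := ℝ)).map_add_univ
    (-(gram σ) : Matrix (Fin n) (Fin n) ℝ) (Matrix.diagonal helmertSq)
  have h0 : (Matrix.diagonal helmertSq - gram σ) = -(gram σ) + Matrix.diagonal helmertSq := by
    rw [sub_eq_neg_add]
  rw [h0]
  refine Eq.trans ?_ h.symm
  refine Finset.sum_congr rfl fun S _ => ?_
  have h1 : (S.piecewise (-(gram σ) : Matrix (Fin n) (Fin n) ℝ) (Matrix.diagonal helmertSq)) =
      Matrix.of fun i j => (if i ∈ S then (-1 : ℝ) else 1) * gramMatrix S σ i j := by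
    ext i j
    by_cases hi : i ∈ S
    · simp [Finset.piecewise, hi, gramMatrix]
    · simp [Finset.piecewise, hi, gramMatrix, Matrix.diagonal_apply, Pi.single_apply, eq_comm]
  rw [h1]
  refine Eq.trans ?_ (Matrix.det_mul_column (fun i => if i ∈ S then (-1 : ℝ) else 1)
    (gramMatrix S σ)).symm
  congr 1
  rw [Finset.prod_ite_mem, Finset.univ_inter, Finset.prod_const]

/-! ### The indicator function of the long cycles -/

/-- The matrix `1 - P_σ + J`, where `P_σ` is the permutation matrix and all entries of `J`
are `1`. -/
def shiftedPermMatrix {d : ℕ} (σ : Perm (Fin d)) : Matrix (Fin d) (Fin d) ℝ :=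
  Matrix.of fun x y => (if x = y then 1 else 0) - (if x = σ y then 1 else 0) + 1

theorem det_shiftedPermMatrix_conj {d : ℕ} (σ τ : Perm (Fin d)) :
    (shiftedPermMatrix (τ * σ * τ⁻¹)).det = (shiftedPermMatrix σ).det := by
  rw [← Matrix.det_submatrix_equiv_self τ (shiftedPermMatrix (τ * σ * τ⁻¹))]
  congr 1
  ext x y
  simp [shiftedPermMatrix]

/-- With more than one orbit there is a nonzero invariant vector of sum zero: weight an orbit by the
size of its complement and the complement by minus the size of the orbit. Both `1 - P_σ` and `J`
annihilate it. -/
theorem det_shiftedPermMatrix_eq_zero {d : ℕ} {σ : Perm (Fin d)}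
    (hσ : ¬ σ.IsCycleOn Set.univ) : (shiftedPermMatrix σ).det = 0 := by
  classical
  have h1 : ∃ x y, ¬ σ.SameCycle x y := by
    by_contra! h
    exact hσ ⟨σ.bijective.bijOn_univ, fun x _ y _ => h x y⟩
  obtain ⟨x, y, hxy⟩ := h1
  rw [← Matrix.exists_mulVec_eq_zero_iff]
  set O := Finset.univ.filter fun z => σ.SameCycle x z with hO
  set w : Fin d → ℝ := fun z => if σ.SameCycle x z then ((Oᶜ).card : ℝ) else -(O.card : ℝ) with hw
  have hinv : ∀ z, w (σ z) = w z := fun z => by simp [hw]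
  have hsum : ∑ z, w z = 0 := by
    rw [← Finset.sum_add_sum_compl O]
    have h1 : ∑ z ∈ O, w z = ∑ z ∈ O, ((Oᶜ).card : ℝ) :=
      Finset.sum_congr rfl fun z hz => if_pos (Finset.mem_filter.mp hz).2
    have h2 : ∑ z ∈ Oᶜ, w z = ∑ z ∈ Oᶜ, -(O.card : ℝ) :=
      Finset.sum_congr rfl fun z hz => if_neg (by simpa [hO] using hz)
    rw [h1, h2, Finset.sum_const, Finset.sum_const, nsmul_eq_mul, nsmul_eq_mul]
    ring
  refine ⟨w, fun h => ?_, ?_⟩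
  · have h0 : w x = 0 := by rw [h]; rfl
    rw [hw] at h0
    simp only [Perm.SameCycle.refl, if_true, Nat.cast_eq_zero, Finset.card_eq_zero] at h0
    have : y ∈ Oᶜ := by simp [hO, hxy]
    rw [h0] at this
    simp at this
  · ext z
    simp only [Matrix.mulVec, dotProduct, shiftedPermMatrix, Matrix.of_apply, Pi.zero_apply,
      add_mul, sub_mul, Finset.sum_add_distrib, Finset.sum_sub_distrib, one_mul, hsum, ite_mul,
      zero_mul]
    rw [Finset.sum_ite_eq, if_pos (Finset.mem_univ _)]
    have : ∀ a, (if z = σ a then w a else 0) = if a = σ⁻¹ z then w a else 0 := by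
      intro a
      congr 1
      exact propext (eq_comm.trans Perm.eq_inv_iff_eq.symm)
    rw [Finset.sum_congr rfl fun a _ => this a, Finset.sum_ite_eq', if_pos (Finset.mem_univ _),
      ← hinv (σ⁻¹ z)]
    simp

/-- The columns are the constant vector and the vectors `helmert j`, `1 ≤ j ≤ n`. -/
def helmertMatrix (n : ℕ) : Matrix (Fin (n + 1)) (Fin (n + 1)) ℝ :=
  Matrix.of fun x i => if i = 0 then 1 else helmert i x

open Matrix in
-- In the basis of the constant vector and the Helmert vectors, `J` contributes only the corner
-- entry `(n + 1) ^ 2` and `1 - P_σ` only the block on the hyperplane. Hence the determinant on the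
-- hyperplane inherits conjugation invariance and vanishing from `shiftedPermMatrix`.
theorem det_diagonal_sub_gram {n : ℕ} (σ : Perm (Fin (n + 1))) :
    (diagonal helmertSq - gram σ).det =
      (helmertMatrix n).det ^ 2 * (shiftedPermMatrix σ).det / (n + 1) ^ 2 := by
  obtain ⟨B, hB⟩ : ∃ B : Matrix (Fin (n + 1)) (Fin (n + 1)) ℝ, B = of fun i j =>
      if i = 0 then (if j = 0 then ((n : ℝ) + 1) ^ 2 else 0) else
        ∑ x, (helmertMatrix n) x i * (helmertMatrix n) x j -
          ∑ x, (helmertMatrix n) (σ x) i * (helmertMatrix n) x j := ⟨_, rfl⟩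
  have h1 : (helmertMatrix n)ᵀ * shiftedPermMatrix σ * helmertMatrix n = B := by
    ext i j
    have hcol : ∀ j : Fin (n + 1), j ≠ 0 → ∑ x, (helmertMatrix n) x j = 0 := by
      intro j hj
      rw [← sum_helmert j]
      exact Finset.sum_congr rfl fun x _ => by simp [helmertMatrix, hj]
    have hentry : ((helmertMatrix n)ᵀ * shiftedPermMatrix σ * helmertMatrix n) i j =
        ∑ x, (helmertMatrix n) x i * (helmertMatrix n) x j -
          ∑ x, (helmertMatrix n) (σ x) i * (helmertMatrix n) x j +
          (∑ x, (helmertMatrix n) x i) * ∑ x, (helmertMatrix n) x j := by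
      rw [mul_apply, Finset.mul_sum, ← Finset.sum_sub_distrib, ← Finset.sum_add_distrib]
      refine Finset.sum_congr rfl fun x _ => ?_
      rw [← sub_mul, ← add_mul]
      congr 1
      rw [mul_apply]
      simp only [transpose_apply, shiftedPermMatrix, of_apply, mul_add, mul_sub, mul_one,
        Finset.sum_add_distrib, Finset.sum_sub_distrib, mul_ite, mul_zero, Finset.sum_ite_eq',
        Finset.mem_univ, if_true]
    rw [hentry, hB, of_apply]
    by_cases hi : i = 0
    · subst hi
      have h0 : ∀ x, helmertMatrix n x 0 = 1 := fun x => by simp [helmertMatrix]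
      by_cases hj : j = 0
      · subst hj
        simp [h0]
        ring
      · simp only [h0, hcol j hj, if_true, if_neg hj, sub_self, mul_zero, add_zero]
    · rw [hcol i hi, zero_mul, add_zero, if_neg hi]
  have h2 := congrArg det h1
  have h3 : B.submatrix Fin.succ (Fin.succAbove 0) = diagonal helmertSq - gram σ := by
    rw [← gram_one]
    ext i j
    simp [hB, gram, helmertMatrix]
  have h4 : B.det = (n + 1) ^ 2 * (diagonal helmertSq - gram σ).det := by
    rw [det_succ_row_zero, Finset.sum_eq_single 0, h3]
    · simp [hB]
    · intro j _ hj
      simp [hB, hj]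
    · simp
  rw [det_mul, det_mul, det_transpose, h4] at h2
  rw [eq_div_iff (by positivity)]
  linarith

theorem isCycleOn_univ_iff_cycleType {d : ℕ} (hd : 2 ≤ d) (σ : Perm (Fin d)) :
    σ.IsCycleOn Set.univ ↔ σ.cycleType = {d} := by
  have : Nontrivial (Fin d) := Fin.nontrivial_iff_two_le.mpr hd
  constructor
  · intro h
    have hc : σ.IsCycle := Perm.isCycle_iff_exists_isCycleOn.mpr
      ⟨Set.univ, Set.nontrivial_univ, h, fun _ _ => Set.mem_univ _⟩
    have hs : σ.support = Finset.univ := by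
      ext x
      simp only [Perm.mem_support, Finset.mem_univ, iff_true]
      exact h.apply_ne Set.nontrivial_univ (Set.mem_univ x)
    rw [hc.cycleType, hs, Finset.card_univ, Fintype.card_fin]
  · intro h
    have hc : σ.IsCycle := by
      rw [← Perm.card_cycleType_eq_one, h, Multiset.card_singleton]
    have hs : σ.support = Finset.univ := by
      rw [← Finset.card_eq_iff_eq_univ, ← Perm.sum_cycleType, h, Multiset.sum_singleton,
        Fintype.card_fin]
    have h2 := hc.isCycleOn
    have h3 : {x | σ x ≠ x} = Set.univ := by
      ext x
      simp only [Set.mem_ofPred_eq, Set.mem_univ, iff_true]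
      rw [← Perm.mem_support, hs]
      exact Finset.mem_univ x
    rwa [h3] at h2

/-- The principal minors of `gram` resolve the indicator function of the long cycles. -/
theorem sum_neg_one_pow_mul_det_gramMatrix_eq {n : ℕ} (hn : 1 ≤ n) (σ : Perm (Fin (n + 1))) :
    ∑ S : Finset (Fin n), (-1) ^ S.card * (gramMatrix S σ).det =
      (Set.indicator {σ : Perm (Fin (n + 1)) | σ.IsCycleOn Set.univ} 1 σ) *
        ((n + 1) * ∏ i : Fin n, helmertSq i) := by
  classical
  set D : Perm (Fin (n + 1)) → ℝ := fun σ =>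
    ∑ S : Finset (Fin n), (-1) ^ S.card * (gramMatrix S σ).det with hD
  have hD' : ∀ σ, D σ =
      (helmertMatrix n).det ^ 2 * (shiftedPermMatrix σ).det / (n + 1) ^ 2 := fun σ => by
    rw [hD, ← det_diagonal_sub_gram, ← sum_neg_one_pow_mul_det_gramMatrix]
  have hzero : ∀ σ, ¬ σ.IsCycleOn Set.univ → D σ = 0 := fun σ hσ => by
    rw [hD', det_shiftedPermMatrix_eq_zero hσ, mul_zero, zero_div]
  have hconst : ∀ σ τ : Perm (Fin (n + 1)), σ.IsCycleOn Set.univ → τ.IsCycleOn Set.univ →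
      D σ = D τ := by
    intro σ τ hσ hτ
    rw [isCycleOn_univ_iff_cycleType (by lia)] at hσ hτ
    obtain ⟨c, hc⟩ := isConj_iff.mp (Perm.isConj_iff_cycleType_eq.mpr (hσ.trans hτ.symm))
    rw [hD', hD', ← hc, det_shiftedPermMatrix_conj]
  -- The value on long cycles is found by averaging: only `S = ∅` contributes to the total, and
  -- there are `n!` long cycles. The determinant of `helmertMatrix` need not be known.
  have hsum : ∑ σ, D σ = ((n + 1).factorial : ℝ) * ∏ i : Fin n, helmertSq i := by
    rw [hD, Finset.sum_comm]
    simp only [← Finset.mul_sum, sum_gramMatrix_det_univ]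
    rw [Finset.sum_eq_single ∅]
    · simp
    · intro S _ hS
      simp [hS]
    · simp
  change D σ = _
  by_cases hσ : σ.IsCycleOn Set.univ
  · rw [Set.indicator_of_mem (by exact hσ), Pi.one_apply, one_mul]
    have h1 : ∑ τ, D τ = (n.factorial : ℝ) * D σ := by
      have h2 : ∀ τ, D τ = if τ.cycleType = {n + 1} then D σ else 0 := by
        intro τ
        have h := isCycleOn_univ_iff_cycleType (by lia) τ
        split_ifs with h'
        · exact hconst τ σ (h.mpr h') hσ
        · exact hzero τ fun h'' => h' (h.mp h'')
      rw [Finset.sum_congr rfl fun τ _ => h2 τ, ← Finset.sum_filter, Finset.sum_const,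
        Perm.card_of_cycleType_singleton (by lia) (by simp), nsmul_eq_mul]
      simp
    rw [hsum, Nat.factorial_succ] at h1
    have h3 : (n.factorial : ℝ) ≠ 0 := by positivity
    push_cast at h1
    apply mul_left_cancel₀ h3
    rw [← h1]
    ring
  · rw [Set.indicator_of_notMem (by exact hσ), zero_mul, hzero σ hσ]

/-! ### Monotone sequences and complete homogeneous polynomials -/

/-- The monotone sequences of `r` transpositions of `Fin d` whose larger entries are below `B`. -/
def monotoneSeq (d r B : ℕ) : Finset (Fin r → Fin d × Fin d) :=
  Finset.univ.filter fun τ => (∀ i, (τ i).1 < (τ i).2) ∧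
    (∀ i k, i ≤ k → (τ i).2 ≤ (τ k).2) ∧ ∀ i, ((τ i).2 : ℕ) < B

/-- The product of a sequence of transpositions. -/
def swapProd {d r : ℕ} (τ : Fin r → Fin d × Fin d) : Perm (Fin d) :=
  (List.ofFn fun i => swap (τ i).1 (τ i).2).prod

theorem swapProd_snoc {d r : ℕ} (τ : Fin r → Fin d × Fin d) (p : Fin d × Fin d) :
    swapProd (Fin.snoc τ p : Fin (r + 1) → Fin d × Fin d) = swapProd τ * swap p.1 p.2 := by
  rw [swapProd, List.ofFn_succ', List.concat_eq_append, List.prod_append, List.prod_singleton]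
  simp [swapProd]

theorem mem_monotoneSeq {d r B : ℕ} {τ : Fin r → Fin d × Fin d} :
    τ ∈ monotoneSeq d r B ↔ (∀ i, (τ i).1 < (τ i).2) ∧
      (∀ i k, i ≤ k → (τ i).2 ≤ (τ k).2) ∧ ∀ i, ((τ i).2 : ℕ) < B := by
  simp [monotoneSeq]

theorem snoc_mem_monotoneSeq {d r : ℕ} {B : Fin d} {τ : Fin r → Fin d × Fin d}
    (hτ : τ ∈ monotoneSeq d r (B + 1)) {a : Fin d} (ha : a < B) :
    (Fin.snoc τ (a, B) : Fin (r + 1) → Fin d × Fin d) ∈ monotoneSeq d (r + 1) (B + 1) := by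
  rw [mem_monotoneSeq] at hτ ⊢
  obtain ⟨h1, h2, h3⟩ := hτ
  refine ⟨fun i => ?_, fun i k => ?_, fun i => ?_⟩
  · refine Fin.lastCases ?_ (fun i => ?_) i
    · simpa using ha
    · simpa using h1 i
  · refine Fin.lastCases ?_ (fun k => ?_) k
    · refine Fin.lastCases (fun _ => le_rfl) (fun i _ => ?_) i
      simpa using Fin.le_def.mpr (Nat.lt_succ_iff.mp (h3 i))
    · refine Fin.lastCases (fun h => ?_) (fun i h => ?_) i
      · exact absurd h (not_le.mpr (Fin.castSucc_lt_last k))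
      · simpa using h2 i k (by simpa using h)
  · refine Fin.lastCases ?_ (fun i => ?_) i
    · simp
    · simpa using h3 i

theorem init_mem_monotoneSeq {d r B : ℕ} {τ : Fin (r + 1) → Fin d × Fin d}
    (hτ : τ ∈ monotoneSeq d (r + 1) B) : (Fin.init τ : Fin r → Fin d × Fin d) ∈
      monotoneSeq d r B := by
  rw [mem_monotoneSeq] at hτ ⊢
  obtain ⟨h1, h2, h3⟩ := hτ
  exact ⟨fun i => h1 _, fun i k h => h2 _ _ (by simpa using h), fun i => h3 _⟩

/-- Either the last, and so the greatest, of the larger entries is below `B`, or it equals `B` and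
the last transposition can be removed. This is the recursion that defines `completeHom`. -/
theorem sum_monotoneSeq_succ {d r : ℕ} (B : Fin d) (F : (Fin (r + 1) → Fin d × Fin d) → ℝ) :
    ∑ τ ∈ monotoneSeq d (r + 1) (B + 1), F τ = ∑ τ ∈ monotoneSeq d (r + 1) B, F τ +
      ∑ τ ∈ monotoneSeq d r (B + 1), ∑ a with a < B, F (Fin.snoc τ (a, B)) := by
  rw [← Finset.sum_filter_add_sum_filter_not _ fun τ => ((τ (Fin.last r)).2 : ℕ) < B]
  congr 1
  · refine Finset.sum_congr ?_ fun _ _ => rfl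
    ext τ
    rw [Finset.mem_filter, mem_monotoneSeq, mem_monotoneSeq]
    constructor
    · rintro ⟨⟨h1, h2, _⟩, h4⟩
      exact ⟨h1, h2, fun i => (Fin.le_def.mp (h2 i _ (Fin.le_last i))).trans_lt h4⟩
    · rintro ⟨h1, h2, h3⟩
      exact ⟨⟨h1, h2, fun i => (h3 i).trans (Nat.lt_succ_self _)⟩, h3 _⟩
  · rw [← Finset.sum_product']
    have hlast : ∀ τ ∈ monotoneSeq d (r + 1) (B + 1), ¬ ((τ (Fin.last r)).2 : ℕ) < B →
        (τ (Fin.last r)).2 = B := by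
      intro τ hτ h
      have := (mem_monotoneSeq.mp hτ).2.2 (Fin.last r)
      exact Fin.ext (by lia)
    refine Finset.sum_nbij' (fun τ => (Fin.init τ, (τ (Fin.last r)).1))
      (fun p => Fin.snoc p.1 (p.2, B)) ?_ ?_ ?_ ?_ ?_
    · intro τ hτ
      rw [Finset.mem_filter] at hτ
      rw [Finset.mem_product]
      refine ⟨init_mem_monotoneSeq hτ.1, ?_⟩
      rw [Finset.mem_filter]
      refine ⟨Finset.mem_univ _, ?_⟩
      rw [← hlast τ hτ.1 hτ.2]
      exact (mem_monotoneSeq.mp hτ.1).1 _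
    · intro p hp
      rw [Finset.mem_product, Finset.mem_filter] at hp
      rw [Finset.mem_filter]
      exact ⟨snoc_mem_monotoneSeq hp.1 hp.2.2, by simp⟩
    · intro τ hτ
      rw [Finset.mem_filter] at hτ
      have : ((τ (Fin.last r)).1, B) = τ (Fin.last r) := by
        rw [← hlast τ hτ.1 hτ.2]
      simp only [this, Fin.snoc_init_self]
    · intro p _
      simp
    · intro τ hτ
      rw [Finset.mem_filter] at hτ
      have : ((τ (Fin.last r)).1, B) = τ (Fin.last r) := by
        rw [← hlast τ hτ.1 hτ.2]
      simp only [this, Fin.snoc_init_self]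

/-- The complete homogeneous symmetric polynomial of degree `r` in `c 0, …, c (d - 1)`. -/
def completeHom (c : ℕ → ℝ) : ℕ → ℕ → ℝ
  | _, 0 => 1
  | 0, _ + 1 => 0
  | d + 1, r + 1 => completeHom c d (r + 1) + c d * completeHom c (d + 1) r

@[simp] theorem completeHom_zero_right (c : ℕ → ℝ) (d : ℕ) : completeHom c d 0 = 1 := by
  cases d <;> simp [completeHom]

@[simp] theorem completeHom_zero_left (c : ℕ → ℝ) (r : ℕ) :
    completeHom c 0 (r + 1) = 0 := by
  simp [completeHom]

theorem completeHom_succ_succ (c : ℕ → ℝ) (d r : ℕ) : completeHom c (d + 1) (r + 1) =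
    completeHom c d (r + 1) + c d * completeHom c (d + 1) r := by
  rw [completeHom]

/-- A joint eigenfunction of the Jucys-Murphy elements, summed over monotone sequences. -/
theorem sum_monotoneSeq_eigenfunction {d : ℕ} {φ : Perm (Fin d) → ℝ} {c : ℕ → ℝ}
    (hφ : ∀ (b : Fin d) (σ : Perm (Fin d)), ∑ a with a < b, φ (σ * swap a b) = c b * φ σ)
    (r B : ℕ) (hB : B ≤ d) :
    ∑ τ ∈ monotoneSeq d r B, φ (swapProd τ) = completeHom c B r * φ 1 := by
  induction r generalizing B with
  | zero =>
    have : monotoneSeq d 0 B = Finset.univ := by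
      ext τ
      simp only [mem_monotoneSeq, Finset.mem_univ, iff_true]
      exact ⟨fun i => i.elim0, fun i => i.elim0, fun i => i.elim0⟩
    rw [this, Fintype.sum_unique]
    simp [swapProd]
  | succ r ihr =>
    induction B with
    | zero =>
      have : monotoneSeq d (r + 1) 0 = ∅ := by
        ext τ
        simp [mem_monotoneSeq]
      rw [this]
      simp
    | succ B ihB =>
      have h := sum_monotoneSeq_succ (r := r) (⟨B, hB⟩ : Fin d) (fun τ => φ (swapProd τ))
      simp only [swapProd_snoc, hφ, ← Finset.mul_sum] at h
      rw [h, ihB (by lia), ihr (B + 1) hB, completeHom_succ_succ]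
      ring

open PowerSeries in
theorem mk_completeHom_mul_prod (c : ℕ → ℝ) (d : ℕ) :
    (PowerSeries.mk (completeHom c d)) * ∏ b ∈ Finset.range d, (1 - C (c b) * X) = 1 := by
  induction d with
  | zero =>
    ext r
    cases r <;> simp [coeff_one]
  | succ d ih =>
    rw [Finset.prod_range_succ, mul_comm _ (1 - C (c d) * X), ← mul_assoc]
    have h : PowerSeries.mk (completeHom c (d + 1)) * (1 - C (c d) * X) =
        PowerSeries.mk (completeHom c d) := by
      ext r
      cases r with
      | zero => simp
      | succ r => ?_
      rw [mul_sub, mul_one, map_sub, ← mul_assoc, coeff_succ_mul_X, mul_comm _ (C _), coeff_C_mul,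
        coeff_mk, coeff_mk, coeff_mk, completeHom_succ_succ]
      ring
    rw [h, ih]

/-! ### Contents of hooks and the exact formula -/

/-- Adding the elements one by one builds a hook: a member of `S` extends the leg, with content one
lower than before, and any other element extends the arm. -/
theorem content_succ {n : ℕ} (S : Finset (Fin n)) (m : Fin n) :
    content S (m + 1) = if m ∈ S then -(((S.filter (· < m)).card : ℝ) + 1) else
      ((Sᶜ.filter (· < m)).card : ℝ) + 1 := by
  have h1 : ∑ j ∈ S, starEigenvalue (m + 1) (j + 1) =
      ((S.filter (· < m)).card : ℝ) + if m ∈ S then (m : ℝ) + 2 else 0 := by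
    rw [Finset.card_filter, Nat.cast_sum, ← Finset.sum_ite_eq' S m fun _ => (m : ℝ) + 2,
      ← Finset.sum_add_distrib]
    refine Finset.sum_congr rfl fun j _ => ?_
    rcases lt_trichotomy j m with h | h | h
    · have h' : (j : ℕ) < m := h
      simp [starEigenvalue, h, h.ne, h'.ne, h'.not_gt]
    · subst h
      simp [starEigenvalue]
      ring
    · have h' : (m : ℕ) < j := h
      simp [starEigenvalue, h', h.not_gt, h.ne']
  have h2 : ((S.filter (· < m)).card : ℝ) + ((Sᶜ.filter (· < m)).card : ℝ) = m := by
    rw [← Nat.cast_add, ← Finset.card_union_of_disjoint, ← Finset.filter_union,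
      Finset.union_compl]
    · have : (Finset.univ.filter fun x : Fin n => x < m) = Finset.Iio m := by ext; simp
      rw [this, Fin.card_Iio]
    · exact Finset.disjoint_filter_filter disjoint_compl_right
  rw [content, h1]
  split_ifs
  · push_cast; ring
  · push_cast; linarith

open PowerSeries in
-- Only the size of `S` matters: the contents are `0`, `1, …, n - |S|` and `-1, …, -|S|` in some
-- order.
theorem prod_one_sub_content {n : ℕ} (S : Finset (Fin n)) :
    ∏ b ∈ Finset.range (n + 1), (1 - C (content S b) * X : PowerSeries ℝ) =
      (∏ i ∈ Finset.range (n - S.card), (1 - C ((i : ℝ) + 1) * X)) *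
        ∏ i ∈ Finset.range S.card, (1 + C ((i : ℝ) + 1) * X) := by
  have key : ∀ m ≤ n, ∏ b ∈ Finset.range (m + 1), (1 - C (content S b) * X : PowerSeries ℝ) =
      (∏ i ∈ Finset.range (Sᶜ.filter fun j : Fin n => (j : ℕ) < m).card,
        (1 - C ((i : ℝ) + 1) * X)) *
        ∏ i ∈ Finset.range (S.filter fun j : Fin n => (j : ℕ) < m).card,
          (1 + C ((i : ℝ) + 1) * X) := by
    intro m
    induction m with
    | zero =>
      intro _
      have : content S 0 = 0 := by
        rw [content, Nat.cast_zero, zero_sub, neg_eq_zero]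
        exact Finset.sum_eq_zero fun j _ => by simp [starEigenvalue]
      simp [this]
    | succ m ih =>
      intro hm
      rw [Finset.prod_range_succ, ih (by lia), content_succ S ⟨m, hm⟩]
      have hcard : ∀ R : Finset (Fin n), (R.filter fun j : Fin n => (j : ℕ) < m + 1).card =
          (R.filter (· < ⟨m, hm⟩)).card + if ⟨m, hm⟩ ∈ R then 1 else 0 := by
        intro R
        rw [Finset.card_filter, Finset.card_filter,
          ← Finset.sum_ite_eq' R ⟨m, hm⟩ fun _ => 1, ← Finset.sum_add_distrib]
        refine Finset.sum_congr rfl fun j _ => ?_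
        simp only [Fin.lt_def, Fin.ext_iff]
        split_ifs <;> lia
      have hcard' : ∀ R : Finset (Fin n), (R.filter fun j : Fin n => (j : ℕ) < m) =
          R.filter (· < ⟨m, hm⟩) := fun R => by simp only [Fin.lt_def]
      rw [hcard, hcard, hcard', hcard']
      by_cases h : (⟨m, hm⟩ : Fin n) ∈ S
      · rw [if_pos h, if_pos h, if_neg (by simpa using h), Finset.prod_range_succ, add_zero]
        simp only [map_neg, neg_mul, sub_neg_eq_add]
        ring
      · rw [if_neg h, if_neg h, if_pos (by simpa using h), Finset.prod_range_succ, add_zero]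
        ring
  have h := key n le_rfl
  simpa [Finset.card_compl] using h

/-- A homogeneous Vandermonde identity for falling factorials. -/
theorem sum_choose_mul_prod_sub {R : Type*} [CommRing R] (x a b : R) (n : ℕ) :
    ∑ k ∈ Finset.range (n + 1), (n.choose k : R) *
      ((∏ i ∈ Finset.range k, (a - i * x)) * ∏ i ∈ Finset.range (n - k), (b - i * x)) =
      ∏ i ∈ Finset.range n, (a + b - i * x) := by
  induction n with
  | zero => simp
  | succ n ih =>
    rw [Finset.prod_range_succ, ← ih, Finset.sum_mul, Finset.sum_range_succ']
    have h1 : ∀ k ∈ Finset.range (n + 1), ((n + 1).choose (k + 1) : R) *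
        ((∏ i ∈ Finset.range (k + 1), (a - i * x)) *
          ∏ i ∈ Finset.range (n + 1 - (k + 1)), (b - i * x)) =
        (n.choose k : R) * ((∏ i ∈ Finset.range (k + 1), (a - i * x)) *
          ∏ i ∈ Finset.range (n - k), (b - i * x)) +
        (n.choose (k + 1) : R) * ((∏ i ∈ Finset.range (k + 1), (a - i * x)) *
          ∏ i ∈ Finset.range (n - k), (b - i * x)) := by
      intro k _
      rw [Nat.choose_succ_succ, Nat.add_sub_add_right]
      push_cast
      ring
    have h2 : ∑ k ∈ Finset.range (n + 1), (n.choose (k + 1) : R) *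
          ((∏ i ∈ Finset.range (k + 1), (a - i * x)) *
            ∏ i ∈ Finset.range (n - k), (b - i * x)) +
        ∏ i ∈ Finset.range (n + 1), (b - i * x) =
        ∑ k ∈ Finset.range (n + 1), (n.choose k : R) *
          ((∏ i ∈ Finset.range k, (a - i * x)) *
            ∏ i ∈ Finset.range (n + 1 - k), (b - i * x)) := by
      rw [Finset.sum_range_succ, Nat.choose_succ_self, Nat.cast_zero, zero_mul, add_zero,
        Finset.sum_range_succ' _ n]
      simp only [Nat.choose_zero_right, Nat.cast_one, one_mul, Finset.prod_range_zero,
        Nat.sub_zero]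
      congr 1
      refine Finset.sum_congr rfl fun k hk => ?_
      rw [Nat.add_sub_add_right]
    rw [Finset.sum_congr rfl h1, Finset.sum_add_distrib]
    simp only [Nat.choose_zero_right, Nat.cast_one, one_mul, Finset.prod_range_zero, Nat.sub_zero]
    rw [add_assoc, h2, ← Finset.sum_add_distrib]
    refine Finset.sum_congr rfl fun k hk => ?_
    have hk : k ≤ n := Nat.lt_succ_iff.mp (Finset.mem_range.mp hk)
    rw [Nat.succ_sub hk, Finset.prod_range_succ, Finset.prod_range_succ, Nat.cast_sub hk]
    ring

/-- The complete homogeneous symmetric polynomial of degree `g` in `1 ^ 2, …, n ^ 2`: a central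
factorial number. -/
def centralFactorial (n g : ℕ) : ℝ := completeHom (fun k => ((k : ℝ) + 1) ^ 2) n g

theorem centralFactorial_succ_succ (n g : ℕ) : centralFactorial (n + 1) (g + 1) =
    centralFactorial n (g + 1) + ((n : ℝ) + 1) ^ 2 * centralFactorial (n + 1) g :=
  completeHom_succ_succ _ _ _

@[simp] theorem centralFactorial_zero_right (n : ℕ) : centralFactorial n 0 = 1 :=
  completeHom_zero_right _ _

@[simp] theorem centralFactorial_zero_left (g : ℕ) : centralFactorial 0 (g + 1) = 0 :=
  completeHom_zero_left _ _

theorem ncard_monotoneFactorisations {n : ℕ} (hn : 1 ≤ n) (r : ℕ) :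
    ((n : ℝ) + 1) * ((monotoneFactorisations (n + 1) r).ncard : ℝ) =
      ∑ S : Finset (Fin n), (-1) ^ S.card * completeHom (content S) (n + 1) r := by
  classical
  set Z : ℝ := ∏ i : Fin n, helmertSq i with hZ
  have hZ0 : Z ≠ 0 := Finset.prod_ne_zero_iff.mpr fun i _ => by
    unfold helmertSq
    positivity
  have h1 : (monotoneFactorisations (n + 1) r).ncard =
      ((monotoneSeq (n + 1) r (n + 1)).filter
        fun τ => (swapProd τ).IsCycleOn Set.univ).card := by
    rw [← Set.ncard_coe_finset]
    congr 1
    ext τ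
    rw [Finset.mem_coe, Finset.mem_filter, mem_monotoneSeq]
    simp only [monotoneFactorisations, Set.mem_ofPred_eq, swapProd]
    constructor
    · rintro ⟨h1, h2, h3⟩
      exact ⟨⟨h1, h2, fun i => (τ i).2.isLt⟩, h3⟩
    · rintro ⟨⟨h1, h2, _⟩, h3⟩
      exact ⟨h1, h2, h3⟩
  have h2 : (((monotoneFactorisations (n + 1) r).ncard : ℕ) : ℝ) =
      ∑ τ ∈ monotoneSeq (n + 1) r (n + 1),
        Set.indicator {σ : Perm (Fin (n + 1)) | σ.IsCycleOn Set.univ} (1 : Perm (Fin (n + 1)) → ℝ)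
          (swapProd τ) := by
    rw [h1, Finset.card_filter, Nat.cast_sum]
    refine Finset.sum_congr rfl fun τ _ => ?_
    simp [Set.indicator_apply]
  have h3 : ((n : ℝ) + 1) * Z * ((monotoneFactorisations (n + 1) r).ncard : ℝ) =
      Z * ∑ S : Finset (Fin n), (-1) ^ S.card * completeHom (content S) (n + 1) r := by
    rw [h2, mul_comm, Finset.sum_mul]
    simp only [hZ, ← sum_neg_one_pow_mul_det_gramMatrix_eq hn]
    rw [Finset.sum_comm, Finset.mul_sum]
    refine Finset.sum_congr rfl fun S _ => ?_
    rw [← Finset.mul_sum, sum_monotoneSeq_eigenfunction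
      (φ := fun σ => (gramMatrix S σ).det) (c := content S)
      (fun b σ => sum_det_gramMatrix_mul_swap S σ b) r (n + 1) le_rfl]
    simp only [gramMatrix_one, Matrix.det_diagonal]
    ring
  apply mul_left_cancel₀ hZ0
  rw [← h3]
  ring

open PowerSeries in
theorem mk_centralFactorial_mul_prod (n : ℕ) :
    (PowerSeries.mk fun r => if Even r then centralFactorial n (r / 2) else 0) *
      ∏ i ∈ Finset.range n, ((1 - C ((i : ℝ) + 1) * X) * (1 + C ((i : ℝ) + 1) * X)) = 1 := by
  induction n with
  | zero =>
    ext r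
    rcases r with _ | _ | r
    · simp
    · simp [coeff_one]
    · have : (r + 1 + 1) / 2 = r / 2 + 1 := by lia
      simp [coeff_one, this]
  | succ n ih =>
    rw [Finset.prod_range_succ, mul_comm (∏ i ∈ Finset.range n, _), ← mul_assoc]
    refine Eq.trans ?_ ih
    congr 1
    have h : (1 - C ((n : ℝ) + 1) * X) * (1 + C ((n : ℝ) + 1) * X) =
        1 - C (((n : ℝ) + 1) ^ 2) * (X : PowerSeries ℝ) ^ 2 := by
      rw [map_pow]
      ring
    rw [h, mul_sub, mul_one]
    ext r
    rw [map_sub, mul_left_comm, coeff_C_mul, coeff_mul_X_pow']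
    rcases r with _ | _ | r
    · simp
    · simp
    · have h2 : (r + 1 + 1) / 2 = r / 2 + 1 := by lia
      have h3 : Even (r + 1 + 1) ↔ Even r := by simp [Nat.even_add_one]
      simp only [coeff_mk, h2, h3]
      rw [if_pos (show 2 ≤ r + 1 + 1 by lia)]
      have h4 : r + 1 + 1 - 2 = r := by lia
      rw [h4]
      split_ifs
      · rw [centralFactorial_succ_succ]
        ring
      · simp

open PowerSeries in
-- This puts the hooks of all shapes over the common denominator `∏ (1 - i² X²)`. The missing
-- factors are written as falling factorials of `n X - 1` and `n X + 1` with step `X`, ready for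
-- `sum_choose_mul_prod_sub`.
theorem prod_one_sub_sq (n k : ℕ) (hk : k ≤ n) :
    ∏ i ∈ Finset.range n, ((1 - C ((i : ℝ) + 1) * X) * (1 + C ((i : ℝ) + 1) * X)) =
      ((∏ i ∈ Finset.range (n - k), (1 - C ((i : ℝ) + 1) * X)) *
        ∏ i ∈ Finset.range k, (1 + C ((i : ℝ) + 1) * X)) *
      ((-1) ^ k * ((∏ i ∈ Finset.range k, (C (n : ℝ) * X - 1 - (i : PowerSeries ℝ) * X)) *
        ∏ i ∈ Finset.range (n - k), (C (n : ℝ) * X + 1 - (i : PowerSeries ℝ) * X))) := by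
  have h1 : ∀ (f : ℕ → PowerSeries ℝ) (m : ℕ), m ≤ n → ∏ i ∈ Finset.range n, f i =
      (∏ i ∈ Finset.range (n - m), f i) * ∏ i ∈ Finset.range m, f (n - 1 - i) := by
    intro f m hm
    have h2 := Finset.prod_range_add f (n - m) m
    rw [Nat.sub_add_cancel hm] at h2
    rw [h2]
    congr 1
    rw [← Finset.prod_range_reflect]
    refine Finset.prod_congr rfl fun i hi => ?_
    have := Finset.mem_range.mp hi
    congr 1
    lia
  have hcast : ∀ i : ℕ, (i : PowerSeries ℝ) = C (i : ℝ) := fun i => by simp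
  have hA : (-1 : PowerSeries ℝ) ^ k *
      ∏ i ∈ Finset.range k, (C (n : ℝ) * X - 1 - (i : PowerSeries ℝ) * X) =
      ∏ i ∈ Finset.range k, (1 - C (((n - 1 - i : ℕ) : ℝ) + 1) * X) := by
    have h3 := Finset.prod_const (s := Finset.range k) (-1 : PowerSeries ℝ)
    rw [Finset.card_range] at h3
    rw [← h3, ← Finset.prod_mul_distrib]
    refine Finset.prod_congr rfl fun i hi => ?_
    have := Finset.mem_range.mp hi
    have h4 : ((n - 1 - i : ℕ) : ℝ) + 1 = n - i := by
      rw [Nat.sub_sub, Nat.cast_sub (by lia)]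
      push_cast
      ring
    rw [h4, map_sub, hcast]
    ring
  have hB : ∏ i ∈ Finset.range (n - k), (C (n : ℝ) * X + 1 - (i : PowerSeries ℝ) * X) =
      ∏ i ∈ Finset.range (n - k), (1 + C (((n - 1 - i : ℕ) : ℝ) + 1) * X) := by
    refine Finset.prod_congr rfl fun i hi => ?_
    have := Finset.mem_range.mp hi
    have h4 : ((n - 1 - i : ℕ) : ℝ) + 1 = n - i := by
      rw [Nat.sub_sub, Nat.cast_sub (by lia)]
      push_cast
      ring
    rw [h4, map_sub, hcast]
    ring
  rw [← mul_assoc ((-1) ^ k), hA, hB, Finset.prod_mul_distrib, h1 _ k hk,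
    h1 (fun i => 1 + C ((i : ℝ) + 1) * X) (n - k) (Nat.sub_le _ _), Nat.sub_sub_self hk]
  ring

open PowerSeries in
theorem sum_completeHom_content (n g : ℕ) :
    ∑ S : Finset (Fin n), (-1) ^ S.card * completeHom (content S) (n + 1) (n + 2 * g) =
      ((2 * n).descFactorial n : ℝ) * centralFactorial n g := by
  set Tot : PowerSeries ℝ :=
    ∏ i ∈ Finset.range n, ((1 - C ((i : ℝ) + 1) * X) * (1 + C ((i : ℝ) + 1) * X)) with hTot
  set U : PowerSeries ℝ := PowerSeries.mk fun r =>
    if Even r then centralFactorial n (r / 2) else 0 with hU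
  have hUT : U * Tot = 1 := mk_centralFactorial_mul_prod n
  have h1 : ∀ S : Finset (Fin n), PowerSeries.mk (completeHom (content S) (n + 1)) =
      U * ((-1) ^ S.card *
        ((∏ i ∈ Finset.range S.card, (C (n : ℝ) * X - 1 - (i : PowerSeries ℝ) * X)) *
        ∏ i ∈ Finset.range (n - S.card), (C (n : ℝ) * X + 1 - (i : PowerSeries ℝ) * X))) := by
    intro S
    have hS : S.card ≤ n := by simpa using S.card_le_univ
    have h2 := mk_completeHom_mul_prod (content S) (n + 1)
    rw [prod_one_sub_content] at h2
    have h3 := prod_one_sub_sq n S.card hS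
    rw [← hTot] at h3
    have h4 : PowerSeries.mk (completeHom (content S) (n + 1)) =
        PowerSeries.mk (completeHom (content S) (n + 1)) * (U * Tot) := by rw [hUT, mul_one]
    rw [h4, h3]
    linear_combination (U * ((-1) ^ S.card *
        ((∏ i ∈ Finset.range S.card, (C (n : ℝ) * X - 1 - (i : PowerSeries ℝ) * X)) *
        ∏ i ∈ Finset.range (n - S.card), (C (n : ℝ) * X + 1 - (i : PowerSeries ℝ) * X)))) * h2
  have h4 : ∑ S : Finset (Fin n), (-1) ^ S.card *
      PowerSeries.mk (completeHom (content S) (n + 1)) =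
      U * (C ((2 * n).descFactorial n : ℝ) * X ^ n) := by
    -- In the sum of the two Vandermonde arguments the constants `-1` and `1` cancel, so the product
    -- is a monomial of degree `n`.
    have h5 : ∏ i ∈ Finset.range n,
        (C (n : ℝ) * X - 1 + (C (n : ℝ) * X + 1) - (i : PowerSeries ℝ) * X) =
        C ((2 * n).descFactorial n : ℝ) * X ^ n := by
      have h6 : ∀ i ∈ Finset.range n,
          (C (n : ℝ) * X - 1 + (C (n : ℝ) * X + 1) - (i : PowerSeries ℝ) * X) =
          C ((2 * n - i : ℕ) : ℝ) * X := by
        intro i hi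
        have hi := Finset.mem_range.mp hi
        rw [Nat.cast_sub (by lia)]
        push_cast
        simp only [map_sub, map_mul, map_natCast, map_ofNat]
        ring
      rw [Finset.prod_congr rfl h6, Finset.prod_mul_distrib, Finset.prod_const, Finset.card_range,
        ← map_prod, ← Nat.cast_prod, ← Nat.descFactorial_eq_prod_range]
    rw [← h5, ← sum_choose_mul_prod_sub, Finset.mul_sum]
    have h7 := Finset.sum_powerset_apply_card (x := (Finset.univ : Finset (Fin n))) (fun k =>
      U * ((∏ i ∈ Finset.range k,
      (C (n : ℝ) * X - 1 - (i : PowerSeries ℝ) * X)) *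
        ∏ i ∈ Finset.range (n - k), (C (n : ℝ) * X + 1 - (i : PowerSeries ℝ) * X)))
    rw [Finset.powerset_univ, Finset.card_univ, Fintype.card_fin] at h7
    refine Eq.trans (Finset.sum_congr rfl fun S _ => ?_) (h7.trans ?_)
    · rw [h1]
      -- The sign of the alternating sum cancels the sign from reversing the factors `1 - (n - i)
      -- X`.
      have : ((-1 : PowerSeries ℝ) ^ S.card) * (-1) ^ S.card = 1 := by
        rw [← mul_pow]
        simp
      linear_combination (U * ((∏ i ∈ Finset.range S.card,
        (C (n : ℝ) * X - 1 - (i : PowerSeries ℝ) * X)) *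
        ∏ i ∈ Finset.range (n - S.card), (C (n : ℝ) * X + 1 - (i : PowerSeries ℝ) * X))) * this
    · refine Finset.sum_congr rfl fun k _ => ?_
      rw [nsmul_eq_mul]
      ring
  have h8 := congrArg (coeff (n + 2 * g)) h4
  rw [map_sum, mul_left_comm, coeff_C_mul, add_comm n, coeff_mul_X_pow] at h8
  have h9 : ∀ S : Finset (Fin n), coeff (2 * g + n) ((-1) ^ S.card *
      PowerSeries.mk (completeHom (content S) (n + 1))) =
      (-1) ^ S.card * completeHom (content S) (n + 1) (n + 2 * g) := by
    intro S
    have : ((-1 : PowerSeries ℝ) ^ S.card) = C ((-1) ^ S.card) := by simp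
    rw [this, coeff_C_mul, coeff_mk, add_comm (2 * g) n]
  rw [← Finset.sum_congr rfl fun S _ => h9 S, h8, hU, coeff_mk, if_pos (by simp)]
  simp

/-- The one-part monotone Hurwitz numbers are Catalan numbers times central factorial numbers. -/
theorem E_eq {n : ℕ} (hn : 1 ≤ n) (g : ℕ) :
    E n g = (n.centralBinom : ℝ) / (n + 1) * centralFactorial n g := by
  have h1 := ncard_monotoneFactorisations hn (n + 2 * g)
  rw [sum_completeHom_content] at h1
  have h2 : n + 1 + 2 * g - 1 = n + 2 * g := by lia
  rw [E, m, h2, Nat.add_sub_cancel]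
  have h3 : ((2 * n).descFactorial n : ℝ) = n.factorial * (n.centralBinom : ℝ) := by
    rw [Nat.descFactorial_eq_factorial_mul_choose, Nat.centralBinom]
    push_cast
    ring
  rw [h3] at h1
  have h4 : (n.factorial : ℝ) ≠ 0 := by positivity
  field_simp
  linear_combination h1

end

/-! ### Central factorial numbers as Taylor coefficients -/

/-- The alternating sums of powers that give the central factorial numbers. -/
def alternatingPowerSum (n M : ℕ) : ℝ :=
  ∑ j ∈ Finset.range (2 * n + 1), (-1) ^ j * ((2 * n).choose j : ℝ) * ((n : ℝ) - j) ^ M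

/-- Since `(n + 1 - j)² = (n + 1)² - j (2 n + 2 - j)`, and the factor `j (2 n + 2 - j)` is absorbed
by the binomial coefficient, this is the recurrence of `centralFactorial` up to the factor `(2 n)!`.
-/
theorem alternatingPowerSum_succ (n M : ℕ) : alternatingPowerSum (n + 1) (M + 2) =
    ((n : ℝ) + 1) ^ 2 * alternatingPowerSum (n + 1) M +
      (2 * n + 2) * (2 * n + 1) * alternatingPowerSum n M := by
  have hch : ∀ i : ℕ, i ≤ 2 * n →
      ((i : ℝ) + 1) * (2 * n + 1 - i) * ((2 * n + 2).choose (i + 1) : ℝ) =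
      (2 * n + 2) * (2 * n + 1) * ((2 * n).choose i : ℝ) := by
    intro i hi
    have h1 : ((2 * n + 2 : ℕ) : ℝ) * ((2 * n + 1).choose i : ℝ) =
        ((2 * n + 2).choose (i + 1) : ℝ) * ((i : ℝ) + 1) := by
      exact_mod_cast Nat.add_one_mul_choose_eq (2 * n + 1) i
    have h2 : ((2 * n + 1 : ℕ) : ℝ) * ((2 * n).choose i : ℝ) =
        ((2 * n + 1).choose i : ℝ) * (2 * n + 1 - i) := by
      have h := Nat.choose_mul_succ_eq (2 * n) i
      have h3 : ((2 * n + 1 - i : ℕ) : ℝ) = 2 * n + 1 - i := by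
        rw [Nat.cast_sub (by lia)]
        push_cast
        ring
      rw [← h3]
      have h4 : (((2 * n).choose i * (2 * n + 1) : ℕ) : ℝ) =
          (((2 * n + 1).choose i * (2 * n + 1 - i) : ℕ) : ℝ) := by rw [h]
      push_cast at h4 ⊢
      linarith
    push_cast at h1 h2
    linear_combination (-(2 * n + 1 - i : ℝ)) * h1 - (2 * n + 2 : ℝ) * h2
  have h1 : alternatingPowerSum (n + 1) (M + 2) -
      ((n : ℝ) + 1) ^ 2 * alternatingPowerSum (n + 1) M =
      ∑ j ∈ Finset.range (2 * (n + 1) + 1), (-1) ^ j * ((2 * (n + 1)).choose j : ℝ) *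
        ((n : ℝ) + 1 - j) ^ M * (-(j * (2 * n + 2 - j))) := by
    rw [alternatingPowerSum, alternatingPowerSum, Finset.mul_sum, ← Finset.sum_sub_distrib]
    refine Finset.sum_congr rfl fun j _ => ?_
    push_cast
    ring
  have h2 : 2 * (n + 1) = 2 * n + 1 + 1 := by ring
  rw [← sub_eq_iff_eq_add', h1, Finset.sum_range_succ]
  nth_rewrite 1 [h2]
  rw [Finset.sum_range_succ', alternatingPowerSum, Finset.mul_sum]
  push_cast
  simp only [zero_mul, neg_zero, mul_zero, add_zero]
  rw [show (2 * (n + 1 : ℝ)) = 2 * n + 2 by ring, sub_self, mul_zero, neg_zero, mul_zero, add_zero]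
  refine Finset.sum_congr rfl fun i hi => ?_
  have hi : i ≤ 2 * n := by
    have := Finset.mem_range.mp hi
    lia
  have h4 := hch i hi
  rw [show 2 * (n + 1) = 2 * n + 2 by ring]
  rw [show (n : ℝ) + 1 - (i + 1) = n - i by ring, pow_succ]
  linear_combination ((-1) ^ i * ((n : ℝ) - i) ^ M) * h4

theorem alternatingPowerSum_even_eq_zero (n : ℕ) : ∀ k < n, alternatingPowerSum n (2 * k) = 0 := by
  induction n with
  | zero => exact fun k hk => absurd hk (Nat.not_lt_zero k)
  | succ n ihn =>
    intro k
    induction k with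
    | zero =>
      intro _
      have h := Int.alternating_sum_range_choose_of_ne (show 2 * (n + 1) ≠ 0 by lia)
      have h' : (∑ j ∈ Finset.range (2 * (n + 1) + 1),
          (-1 : ℝ) ^ j * ((2 * (n + 1)).choose j : ℝ)) = 0 := by
        exact_mod_cast congrArg (Int.cast : ℤ → ℝ) h
      simpa [alternatingPowerSum] using h'
    | succ k ihk =>
      intro hk
      rw [mul_add, mul_one, alternatingPowerSum_succ, ihk (by lia), ihn k (by lia)]
      ring

theorem alternatingPowerSum_eq (n g : ℕ) :
    alternatingPowerSum n (2 * (n + g)) = ((2 * n).factorial : ℝ) * centralFactorial n g := by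
  induction n generalizing g with
  | zero =>
    cases g with
    | zero => simp [alternatingPowerSum]
    | succ g => simp [alternatingPowerSum]
  | succ n ihn =>
    have hf : (((2 * (n + 1)).factorial : ℕ) : ℝ) =
        (2 * n + 2) * (2 * n + 1) * ((2 * n).factorial : ℝ) := by
      rw [show 2 * (n + 1) = 2 * n + 1 + 1 by ring, Nat.factorial_succ, Nat.factorial_succ]
      push_cast
      ring
    induction g with
    | zero =>
      rw [show 2 * (n + 1 + 0) = 2 * n + 2 by ring, alternatingPowerSum_succ,
        alternatingPowerSum_even_eq_zero (n + 1) n (by lia)]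
      have := ihn 0
      rw [add_zero, centralFactorial_zero_right] at this
      rw [this, show 2 * n + 2 = 2 * (n + 1) by ring, hf, centralFactorial_zero_right]
      ring
    | succ g ihg =>
      rw [show 2 * (n + 1 + (g + 1)) = 2 * (n + 1 + g) + 2 by ring, alternatingPowerSum_succ, ihg,
        show 2 * (n + 1 + g) = 2 * (n + (g + 1)) by ring, ihn, centralFactorial_succ_succ, hf]
      ring

open Complex in
theorem integral_exp_int_mul_I (k : ℤ) :
    ∫ t in (-Real.pi)..Real.pi, cexp (k * t * I) = if k = 0 then 2 * (Real.pi : ℂ) else 0 := by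
  split_ifs with hk
  · subst hk
    simp
    ring
  · have hc : (k : ℂ) * I ≠ 0 := mul_ne_zero (by exact_mod_cast hk) I_ne_zero
    have h := integral_exp_mul_complex (a := -Real.pi) (b := Real.pi) hc
    have h2 : ∀ t : ℝ, cexp (k * t * I) = cexp (k * I * t) := fun t => by ring_nf
    simp only [h2, h]
    rw [div_eq_zero_iff]
    left
    rw [sub_eq_zero, Complex.exp_eq_exp_iff_exists_int]
    exact ⟨k, by push_cast; ring⟩

open Complex in
/-- The Taylor coefficients of the exponential function as Fourier coefficients. -/
theorem integral_exp_mul_exp (c : ℂ) (M : ℕ) :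
    ∫ t in (-Real.pi)..Real.pi, cexp (c * cexp (t * I)) * cexp (-(M * t * I)) =
      2 * Real.pi * c ^ M / M.factorial := by
  set F : ℕ → ℝ → ℂ := fun k t =>
    c ^ k / k.factorial * cexp (((k : ℤ) - M : ℤ) * t * I) with hF
  have hcont : ∀ k, Continuous (F k) := fun k => by rw [hF]; fun_prop
  have hnorm : ∀ k t, ‖F k t‖ = ‖c‖ ^ k / k.factorial := by
    intro k t
    rw [hF]
    simp only [norm_mul, norm_div, norm_pow]
    have : ((((k : ℤ) - M : ℤ) : ℂ) * t * I) = (((k : ℝ) - M) * t : ℝ) * I := by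
      push_cast; ring
    rw [this, norm_exp_ofReal_mul_I, mul_one]
    simp
  have hsum : HasSum (fun k => ∫ t in (-Real.pi)..Real.pi, F k t)
      (∫ t in (-Real.pi)..Real.pi, ∑' k, F k t) := by
    have hle : -Real.pi ≤ Real.pi := by linarith [Real.pi_pos]
    refine intervalIntegral.hasSum_integral_of_dominated_convergence
      (fun k _ => ‖c‖ ^ k / k.factorial) (fun k => (hcont k).aestronglyMeasurable) ?_ ?_ ?_ ?_
    · exact fun k => Eventually.of_forall fun t _ => (hnorm k t).le
    · exact Eventually.of_forall fun t _ => Real.summable_pow_div_factorial _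
    · exact _root_.continuous_const.intervalIntegrable _ _
    · refine Eventually.of_forall fun t _ => Summable.hasSum ?_
      refine Summable.of_norm ?_
      simp only [hnorm]
      exact Real.summable_pow_div_factorial _
  have h1 : ∀ t : ℝ, ∑' k, F k t = cexp (c * cexp (t * I)) * cexp (-(M * t * I)) := by
    intro t
    have hexp : cexp (c * cexp (t * I)) = ∑' k : ℕ, (c * cexp (t * I)) ^ k / k.factorial := by
      rw [congrFun Complex.exp_eq_exp_ℂ, NormedSpace.exp_eq_tsum_div (𝔸 := ℂ)]
    rw [hexp, ← tsum_mul_right]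
    refine tsum_congr fun k => ?_
    rw [hF]
    simp only
    have : ((((k : ℤ) - M : ℤ) : ℂ) * t * I) = k * (t * I) + -(M * t * I) := by
      push_cast; ring
    rw [this, Complex.exp_add, Complex.exp_nat_mul, mul_pow]
    ring
  have h2 : ∀ k, ∫ t in (-Real.pi)..Real.pi, F k t =
      if k = M then 2 * Real.pi * c ^ M / M.factorial else 0 := by
    intro k
    rw [hF]
    simp only
    rw [intervalIntegral.integral_const_mul, integral_exp_int_mul_I]
    by_cases h : k = M
    · subst h
      simp
      ring
    · have : ((k : ℤ) - M) ≠ 0 := by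
        rw [sub_ne_zero]
        exact_mod_cast h
      rw [if_neg this, if_neg h, mul_zero]
  simp only [h1, h2] at hsum
  have h3 := hasSum_ite_eq M (2 * Real.pi * c ^ M / M.factorial : ℂ)
  exact hsum.unique h3

open Complex in
-- The binomial expansion of `(2 sinh z) ^ (2 n)` into exponentials has the alternating power sum as
-- Taylor coefficient; the integral is Cauchy's formula on the circle of radius `u`.
theorem centralFactorial_eq_integral (n g : ℕ) (u : ℝ) :
    ((((2 * n).factorial : ℝ) * centralFactorial n g * (2 * u) ^ (2 * (n + g)) /
      ((2 * (n + g)).factorial : ℝ) * (2 * Real.pi) : ℝ) : ℂ) =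
    ∫ t in (-Real.pi)..Real.pi, (2 * Complex.sinh (u * cexp (t * I))) ^ (2 * n) *
      cexp (-((2 * (n + g) : ℕ) * t * I)) := by
  rw [← alternatingPowerSum_eq]
  have h1 : ∀ t : ℝ, (2 * Complex.sinh (u * cexp (t * I))) ^ (2 * n) *
      cexp (-((2 * (n + g) : ℕ) * t * I)) =
      ∑ j ∈ Finset.range (2 * n + 1), ((-1) ^ j * ((2 * n).choose j : ℂ)) *
        (cexp ((((n : ℂ) - j) * (2 * u)) * cexp (t * I)) *
          cexp (-((2 * (n + g) : ℕ) * t * I))) := by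
    intro t
    have h2 : 2 * Complex.sinh (u * cexp (t * I)) =
        -cexp (-(u * cexp (t * I))) + cexp (u * cexp (t * I)) := by
      rw [Complex.sinh]
      ring
    rw [h2, add_pow, Finset.sum_mul]
    refine Finset.sum_congr rfl fun j hj => ?_
    have hj : j ≤ 2 * n := Nat.lt_succ_iff.mp (Finset.mem_range.mp hj)
    have h3 : cexp ((((n : ℂ) - j) * (2 * u)) * cexp (t * I)) =
        cexp (-(u * cexp (t * I))) ^ j * cexp (u * cexp (t * I)) ^ (2 * n - j) := by
      rw [← Complex.exp_nat_mul, ← Complex.exp_nat_mul, ← Complex.exp_add, Nat.cast_sub hj]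
      congr 1
      push_cast
      ring
    rw [h3, neg_pow]
    ring
  simp only [h1]
  rw [intervalIntegral.integral_finsetSum]
  · simp only [intervalIntegral.integral_const_mul, integral_exp_mul_exp]
    rw [alternatingPowerSum]
    push_cast
    rw [Finset.sum_mul, Finset.sum_div, Finset.sum_mul]
    refine Finset.sum_congr rfl fun j _ => ?_
    rw [mul_pow (_ - _ : ℂ)]
    ring
  · intro j _
    refine Continuous.intervalIntegrable ?_ _ _
    fun_prop

/-! ### A local limit theorem for sums of Bernoulli variables -/

open Complex in
theorem norm_exp_mul_I_sub_taylor_le {x : ℝ} (hx : |x| ≤ Real.pi) :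
    ‖cexp (x * I) - (1 + x * I - (x : ℂ) ^ 2 / 2)‖ ≤ |x| ^ 3 * Real.exp Real.pi := by
  have h := norm_exp_sub_sum_le_norm_mul_exp (x * I) 3
  have h1 : ‖(x : ℂ) * I‖ = |x| := by simp
  have h2 : ∑ k ∈ Finset.range 3, ((x : ℂ) * I) ^ k / k.factorial =
      1 + x * I - (x : ℂ) ^ 2 / 2 := by
    simp only [Finset.sum_range_succ, Finset.sum_range_zero, Nat.factorial]
    push_cast
    rw [mul_pow (x : ℂ) I 2, I_sq]
    ring
  rw [h1, h2] at h
  exact h.trans (by gcongr)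

/-- The characteristic function of a centred Bernoulli variable. -/
def bernoulliChar (p t : ℝ) : ℂ :=
  (1 - p + p * Complex.exp (t * Complex.I)) * Complex.exp (-(p * t * Complex.I))

open Complex in
-- The squared modulus is `1 - 2 p (1 - p) (1 - cos t)`, and `1 - cos t ≥ 2 t² / π²` on `[-π, π]`.
-- Gaussian decay on the whole period removes the need for a separate estimate away from `0`.
theorem norm_bernoulliChar_le {p t : ℝ} (ht : |t| ≤ Real.pi) (hp : 0 ≤ p) (hp1 : p ≤ 1) :
    ‖bernoulliChar p t‖ ≤ Real.exp (-(2 / Real.pi ^ 2 * (p * (1 - p)) * t ^ 2)) := by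
  have h1 : ‖bernoulliChar p t‖ ^ 2 = 1 - 2 * (p * (1 - p)) * (1 - Real.cos t) := by
    have h2 : cexp (-(p * t * I)) = cexp ((-(p * t) : ℝ) * I) := by push_cast; ring_nf
    rw [bernoulliChar, norm_mul, h2, norm_exp_ofReal_mul_I, mul_one, ← normSq_eq_norm_sq, exp_mul_I,
      ← ofReal_cos, ← ofReal_sin]
    have h3 : (1 - p + p * (Real.cos t + Real.sin t * I) : ℂ) =
        ((1 - p + p * Real.cos t : ℝ) : ℂ) + ((p * Real.sin t : ℝ) : ℂ) * I := by
      push_cast; ring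
    rw [h3, normSq_add_mul_I]
    linear_combination p ^ 2 * Real.sin_sq_add_cos_sq t
  have h2 := Real.cos_le_one_sub_mul_cos_sq ht
  have hv : 0 ≤ p * (1 - p) := mul_nonneg hp (sub_nonneg.mpr hp1)
  have h3 : ‖bernoulliChar p t‖ ^ 2 ≤
      (Real.exp (-(2 / Real.pi ^ 2 * (p * (1 - p)) * t ^ 2))) ^ 2 := by
    rw [h1, ← Real.exp_nat_mul]
    have h4 := Real.add_one_le_exp (-(4 / Real.pi ^ 2 * (p * (1 - p)) * t ^ 2))
    have h5 : 2 * (p * (1 - p)) * (2 / Real.pi ^ 2 * t ^ 2) ≤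
        2 * (p * (1 - p)) * (1 - Real.cos t) :=
      mul_le_mul_of_nonneg_left (by linarith) (by positivity)
    have h6 : ((2 : ℕ) : ℝ) * -(2 / Real.pi ^ 2 * (p * (1 - p)) * t ^ 2) =
        -(4 / Real.pi ^ 2 * (p * (1 - p)) * t ^ 2) := by push_cast; ring
    rw [h6]
    refine le_trans ?_ h4
    have h7 : 2 * (p * (1 - p)) * (2 / Real.pi ^ 2 * t ^ 2) =
        4 / Real.pi ^ 2 * (p * (1 - p)) * t ^ 2 := by ring
    linarith
  exact le_of_sq_le_sq h3 (Real.exp_pos _).le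

open Complex in
-- The first moments cancel and the second is `p (1 - p)`. The remainders keep a factor `p (1 - p)`,
-- so that the errors of many factors add up to a multiple of the total variance.
theorem norm_bernoulliChar_sub_le {p t : ℝ} (ht : |t| ≤ Real.pi) (hp : 0 ≤ p) (hp1 : p ≤ 1) :
    ‖bernoulliChar p t - cexp (-(p * (1 - p) * t ^ 2 / 2))‖ ≤
      2 * Real.exp Real.pi * (p * (1 - p)) * |t| ^ 3 := by
  have hq : 0 ≤ 1 - p := sub_nonneg.mpr hp1
  have hv : 0 ≤ p * (1 - p) := mul_nonneg hp hq
  have hv1 : p * (1 - p) ≤ 1 / 4 := by nlinarith [sq_nonneg (p - 1 / 2)]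
  have hpi := Real.pi_pos
  have hpi4 := Real.pi_le_four
  have h0 : bernoulliChar p t = (1 - p) * cexp (((-(p * t) : ℝ) : ℂ) * I) +
      p * cexp ((((1 - p) * t : ℝ) : ℂ) * I) := by
    rw [bernoulliChar, add_mul, mul_assoc (p : ℂ) (cexp (t * I)), ← Complex.exp_add]
    push_cast
    ring_nf
  have h1 := norm_exp_mul_I_sub_taylor_le (x := -(p * t)) (by
    rw [abs_neg, abs_mul, abs_of_nonneg hp]
    exact (mul_le_of_le_one_left (abs_nonneg _) hp1).trans ht)
  have h2 := norm_exp_mul_I_sub_taylor_le (x := (1 - p) * t) (by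
    rw [abs_mul, abs_of_nonneg hq]
    exact (mul_le_of_le_one_left (abs_nonneg _) (by linarith)).trans ht)
  rw [abs_neg, abs_mul, abs_of_nonneg hp] at h1
  rw [abs_mul, abs_of_nonneg hq] at h2
  set y : ℝ := p * (1 - p) * t ^ 2 / 2 with hy
  have ht2 : t ^ 2 = |t| ^ 2 := (sq_abs t).symm
  have hy0 : 0 ≤ y := by positivity
  have hty : t ^ 2 ≤ Real.pi * 4 := by
    rw [ht2, sq]
    exact mul_le_mul ht (ht.trans hpi4) (abs_nonneg _) hpi.le
  have hypi : y ≤ Real.pi := by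
    rw [hy]
    have := mul_le_mul hv1 hty (sq_nonneg t) (by norm_num)
    linarith
  have h3 := norm_exp_sub_sum_le_norm_mul_exp (((-y : ℝ) : ℂ)) 2
  rw [norm_real, Real.norm_eq_abs, abs_neg, abs_of_nonneg hy0] at h3
  have h4 : ∑ k ∈ Finset.range 2, (((-y : ℝ) : ℂ)) ^ k / k.factorial = 1 - y := by
    simp only [Finset.sum_range_succ, Finset.sum_range_zero, Nat.factorial]
    push_cast
    ring
  rw [h4] at h3
  have h5 : bernoulliChar p t - cexp (-(p * (1 - p) * t ^ 2 / 2)) =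
      (1 - p) * (cexp (((-(p * t) : ℝ) : ℂ) * I) -
        (1 + ((-(p * t) : ℝ) : ℂ) * I - ((-(p * t) : ℝ) : ℂ) ^ 2 / 2)) +
      p * (cexp ((((1 - p) * t : ℝ) : ℂ) * I) -
        (1 + (((1 - p) * t : ℝ) : ℂ) * I - (((1 - p) * t : ℝ) : ℂ) ^ 2 / 2)) -
      (cexp (((-y : ℝ) : ℂ)) - (1 - y)) := by
    have : (-(p * (1 - p) * t ^ 2 / 2) : ℂ) = ((-y : ℝ) : ℂ) := by rw [hy]; push_cast; ring
    rw [h0, this]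
    have hy' : (y : ℂ) = p * (1 - p) * t ^ 2 / 2 := by rw [hy]; push_cast; ring
    rw [hy']
    push_cast
    ring
  rw [h5]
  have hnp : ‖(p : ℂ)‖ = p := by rw [norm_real, Real.norm_eq_abs, abs_of_nonneg hp]
  have hnq : ‖(1 - p : ℂ)‖ = 1 - p := by
    rw [show (1 - p : ℂ) = ((1 - p : ℝ) : ℂ) by push_cast; ring, norm_real, Real.norm_eq_abs,
      abs_of_nonneg hq]
  have h9 : ‖(1 - p : ℂ) * (cexp (((-(p * t) : ℝ) : ℂ) * I) -
        (1 + ((-(p * t) : ℝ) : ℂ) * I - ((-(p * t) : ℝ) : ℂ) ^ 2 / 2)) +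
      p * (cexp ((((1 - p) * t : ℝ) : ℂ) * I) -
        (1 + (((1 - p) * t : ℝ) : ℂ) * I - (((1 - p) * t : ℝ) : ℂ) ^ 2 / 2))‖ ≤
      (1 - p) * ((p * |t|) ^ 3 * Real.exp Real.pi) +
        p * (((1 - p) * |t|) ^ 3 * Real.exp Real.pi) := by
    refine (norm_add_le _ _).trans ?_
    rw [norm_mul, norm_mul, hnp, hnq]
    gcongr
  refine (norm_sub_le _ _).trans ((add_le_add h9 h3).trans ?_)
  have h6 : (1 - p) * ((p * |t|) ^ 3 * Real.exp Real.pi) +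
      p * (((1 - p) * |t|) ^ 3 * Real.exp Real.pi) ≤
      Real.exp Real.pi * (p * (1 - p)) * |t| ^ 3 := by
    have : (1 - p) * ((p * |t|) ^ 3 * Real.exp Real.pi) +
      p * (((1 - p) * |t|) ^ 3 * Real.exp Real.pi) =
      (Real.exp Real.pi * (p * (1 - p)) * |t| ^ 3) * (p ^ 2 + (1 - p) ^ 2) := by ring
    rw [this]
    refine mul_le_of_le_one_right (by positivity) ?_
    nlinarith
  have h7 : y ^ 2 * Real.exp y ≤ Real.exp Real.pi * (p * (1 - p)) * |t| ^ 3 := by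
    have h8 : y ^ 2 ≤ (p * (1 - p)) * |t| ^ 3 := by
      have : y ^ 2 = (p * (1 - p) * |t| ^ 3) * ((p * (1 - p)) * |t| / 4) := by
        rw [hy, ht2]; ring
      rw [this]
      refine mul_le_of_le_one_right (by positivity) ?_
      have := mul_le_mul hv1 (ht.trans hpi4) (abs_nonneg _) (by norm_num)
      linarith
    calc y ^ 2 * Real.exp y ≤ ((p * (1 - p)) * |t| ^ 3) * Real.exp Real.pi := by gcongr
      _ = _ := by ring
  linarith

open Complex in
-- The factors are exchanged for Gaussians one at a time; at each exchange the others retain their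
-- Gaussian decay. The constant does not depend on the number of factors.
theorem norm_prod_bernoulliChar_sub_le {ι : Type*} (s : Finset ι) (p : ι → ℝ) {t : ℝ}
    (ht : |t| ≤ Real.pi) (hp : ∀ i, 0 ≤ p i) (hp1 : ∀ i, p i ≤ 1) :
    ‖∏ i ∈ s, bernoulliChar (p i) t - cexp (-((∑ i ∈ s, p i * (1 - p i) : ℝ) * t ^ 2 / 2))‖ ≤
      2 * Real.exp Real.pi * Real.exp (1 / 2) * (∑ i ∈ s, p i * (1 - p i)) * |t| ^ 3 *
        Real.exp (-(2 / Real.pi ^ 2 * (∑ i ∈ s, p i * (1 - p i)) * t ^ 2)) := by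
  classical
  have hv : ∀ i, 0 ≤ p i * (1 - p i) := fun i => mul_nonneg (hp i) (sub_nonneg.mpr (hp1 i))
  have hP : ∀ s : Finset ι, ‖∏ i ∈ s, bernoulliChar (p i) t‖ ≤
      Real.exp (-(2 / Real.pi ^ 2 * (∑ i ∈ s, p i * (1 - p i)) * t ^ 2)) := by
    intro s
    rw [norm_prod, Finset.mul_sum, Finset.sum_mul, ← Finset.sum_neg_distrib, Real.exp_sum]
    exact Finset.prod_le_prod (fun i _ => norm_nonneg _) fun i _ =>
      norm_bernoulliChar_le ht (hp i) (hp1 i)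
  induction s using Finset.induction_on with
  | empty => simp
  | insert i s hi ih =>
    rw [Finset.prod_insert hi, Finset.sum_insert hi]
    set W := ∑ j ∈ s, p j * (1 - p j) with hW
    have hW0 : 0 ≤ W := Finset.sum_nonneg fun j _ => hv j
    set v := p i * (1 - p i) with hvi
    have hv0 : 0 ≤ v := hv i
    set P := ∏ j ∈ s, bernoulliChar (p j) t with hPdef
    set Q := cexp (-((W : ℝ) * t ^ 2 / 2)) with hQ
    have hb : cexp (-(((v + W : ℝ) : ℂ) * t ^ 2 / 2)) =
        cexp (-(p i * (1 - p i) * t ^ 2 / 2)) * Q := by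
      rw [hQ, ← Complex.exp_add, hvi]
      congr 1
      push_cast
      ring
    set b := cexp (-(p i * (1 - p i) * t ^ 2 / 2)) with hbdef
    have hpi := Real.pi_pos
    have hpi3 : 2 ≤ Real.pi := Real.two_le_pi
    have hbn : ‖b‖ ≤ Real.exp (-(2 / Real.pi ^ 2 * v * t ^ 2)) := by
      rw [hbdef, norm_exp]
      have : (-(p i * (1 - p i) * t ^ 2 / 2) : ℂ).re = -(v * t ^ 2 / 2) := by
        rw [show (-(p i * (1 - p i) * t ^ 2 / 2) : ℂ) = ((-(v * t ^ 2 / 2) : ℝ) : ℂ) by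
          rw [hvi]; push_cast; ring, ofReal_re]
      rw [this]
      refine Real.exp_le_exp.mpr (neg_le_neg ?_)
      have h1 : 2 / Real.pi ^ 2 ≤ 1 / 2 := by
        rw [div_le_div_iff₀ (by positivity) (by norm_num)]
        nlinarith
      have h2 : 0 ≤ v * t ^ 2 := by positivity
      nlinarith
    have h1 := norm_bernoulliChar_sub_le ht (hp i) (hp1 i)
    have h2 : bernoulliChar (p i) t * P - b * Q =
        (bernoulliChar (p i) t - b) * P + b * (P - Q) := by ring
    rw [hb, h2]
    have hexp : Real.exp (-(2 / Real.pi ^ 2 * (v + W) * t ^ 2)) =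
        Real.exp (-(2 / Real.pi ^ 2 * v * t ^ 2)) *
          Real.exp (-(2 / Real.pi ^ 2 * W * t ^ 2)) := by
      rw [← Real.exp_add]
      congr 1
      ring
    -- The decay of the exchanged factor is missing from its error term. Restoring it costs at most
    -- `exp (1 / 2)`, as `v ≤ 1 / 4` and `|t| ≤ π`.
    have hone : 1 ≤ Real.exp (1 / 2) * Real.exp (-(2 / Real.pi ^ 2 * v * t ^ 2)) := by
      rw [← Real.exp_add, Real.one_le_exp_iff]
      have h3 : v ≤ 1 / 4 := by
        rw [hvi]
        nlinarith [sq_nonneg (p i - 1 / 2)]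
      have h4 : t ^ 2 ≤ Real.pi ^ 2 := by
        rw [← sq_abs]
        gcongr
      have h5 : 2 / Real.pi ^ 2 * v * t ^ 2 ≤ 2 / Real.pi ^ 2 * (1 / 4) * Real.pi ^ 2 := by
        gcongr
      have h6 : 2 / Real.pi ^ 2 * (1 / 4) * Real.pi ^ 2 = 1 / 2 := by
        field_simp
        norm_num
      linarith
    calc ‖(bernoulliChar (p i) t - b) * P + b * (P - Q)‖
        ≤ ‖bernoulliChar (p i) t - b‖ * ‖P‖ + ‖b‖ * ‖P - Q‖ := by
          refine (norm_add_le _ _).trans ?_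
          rw [norm_mul, norm_mul]
      _ ≤ (2 * Real.exp Real.pi * v * |t| ^ 3) * Real.exp (-(2 / Real.pi ^ 2 * W * t ^ 2)) +
          Real.exp (-(2 / Real.pi ^ 2 * v * t ^ 2)) *
            (2 * Real.exp Real.pi * Real.exp (1 / 2) * W * |t| ^ 3 *
              Real.exp (-(2 / Real.pi ^ 2 * W * t ^ 2))) := by
          gcongr
          exact hP s
      _ ≤ (2 * Real.exp Real.pi * v * |t| ^ 3) * Real.exp (-(2 / Real.pi ^ 2 * W * t ^ 2)) *
          (Real.exp (1 / 2) * Real.exp (-(2 / Real.pi ^ 2 * v * t ^ 2))) +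
          Real.exp (-(2 / Real.pi ^ 2 * v * t ^ 2)) *
            (2 * Real.exp Real.pi * Real.exp (1 / 2) * W * |t| ^ 3 *
              Real.exp (-(2 / Real.pi ^ 2 * W * t ^ 2))) := by
          exact add_le_add_left (le_mul_of_one_le_right (by positivity) hone) _
      _ = _ := by
          rw [hexp]
          ring

theorem integral_abs_pow_three_mul_exp {b : ℝ} (hb : 0 < b) :
    MeasureTheory.Integrable (fun t : ℝ => |t| ^ 3 * Real.exp (-b * t ^ 2)) ∧
    ∫ t : ℝ, |t| ^ 3 * Real.exp (-b * t ^ 2) = 1 / b ^ 2 := by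
  constructor
  · have h := (integrable_rpow_mul_exp_neg_mul_sq hb (s := 3) (by norm_num)).norm
    refine h.congr (Eventually.of_forall fun t => ?_)
    simp only [norm_mul, Real.norm_eq_abs, Real.abs_exp]
    rw [show (3 : ℝ) = ((3 : ℕ) : ℝ) by norm_num, Real.rpow_natCast, abs_pow]
  · have h1 := integral_comp_abs (f := fun t : ℝ => t ^ 3 * Real.exp (-b * t ^ 2))
    simp only [sq_abs] at h1
    rw [h1]
    have h2 := integral_rpow_mul_exp_neg_mul_rpow (p := 2) (q := 3) (b := b) (by norm_num)
      (by norm_num) hb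
    have h3 : ∀ t : ℝ, t ^ (3 : ℝ) * Real.exp (-b * t ^ (2 : ℝ)) =
        t ^ 3 * Real.exp (-b * t ^ 2) := fun t => by
      rw [show (3 : ℝ) = ((3 : ℕ) : ℝ) by norm_num, show (2 : ℝ) = ((2 : ℕ) : ℝ) by norm_num,
        Real.rpow_natCast, Real.rpow_natCast]
    simp only [h3] at h2
    rw [h2, show ((3 : ℝ) + 1) / 2 = 2 by norm_num, Real.Gamma_two,
      show (-(3 + 1 : ℝ) / 2) = ((-2 : ℤ) : ℝ) by norm_num, Real.rpow_intCast]
    rw [zpow_neg]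
    norm_cast
    ring

theorem integral_Ioi_pi_gaussian_le {b : ℝ} (hb : 0 < b) :
    ∫ t in Ioi Real.pi, Real.exp (-b * t ^ 2) ≤ 1 / (2 * b) := by
  have h2 := integral_rpow_mul_exp_neg_mul_rpow (p := 2) (q := 1) (b := b) (by norm_num)
    (by norm_num) hb
  have h3 : ∀ t : ℝ, t ^ (1 : ℝ) * Real.exp (-b * t ^ (2 : ℝ)) =
      t * Real.exp (-b * t ^ 2) := fun t => by
    rw [show (2 : ℝ) = ((2 : ℕ) : ℝ) by norm_num, Real.rpow_natCast, Real.rpow_one]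
  simp only [h3] at h2
  have h4 : b ^ (-(1 + 1 : ℝ) / 2) * (1 / 2) * Real.Gamma ((1 + 1) / 2) = 1 / (2 * b) := by
    rw [show ((1 : ℝ) + 1) / 2 = 1 by norm_num, Real.Gamma_one,
      show (-(1 + 1 : ℝ) / 2) = -1 by norm_num, Real.rpow_neg_one]
    field_simp
  rw [h4] at h2
  have hint := integrable_mul_exp_neg_mul_sq hb
  rw [← h2]
  -- Beyond `π` one has `t ≥ 1`, so a factor `t` may be inserted, which makes the integral
  -- elementary.
  calc ∫ t in Ioi Real.pi, Real.exp (-b * t ^ 2)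
      ≤ ∫ t in Ioi Real.pi, t * Real.exp (-b * t ^ 2) := by
        refine MeasureTheory.setIntegral_mono_on (integrable_exp_neg_mul_sq hb).integrableOn
          hint.integrableOn measurableSet_Ioi fun t ht => ?_
        have : 1 ≤ t := by
          have := Set.mem_Ioi.mp ht
          linarith [Real.two_le_pi]
        exact le_mul_of_one_le_left (Real.exp_pos _).le this
    _ ≤ ∫ t in Ioi 0, t * Real.exp (-b * t ^ 2) := by
        refine MeasureTheory.setIntegral_mono_set hint.integrableOn ?_
          (Ioi_subset_Ioi Real.pi_pos.le).eventuallyLE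
        refine (MeasureTheory.ae_restrict_iff' measurableSet_Ioi).mpr
          (Eventually.of_forall fun t ht => ?_)
        have := (Set.mem_Ioi.mp ht).le
        change 0 ≤ t * Real.exp (-b * t ^ 2)
        positivity

theorem abs_integral_gaussian_sub_le {b : ℝ} (hb : 0 < b) :
    |(∫ t in (-Real.pi)..Real.pi, Real.exp (-b * t ^ 2)) - √(Real.pi / b)| ≤ 1 / b := by
  have hint := integrable_exp_neg_mul_sq hb
  have h1 : (∫ t in Iic (-Real.pi), Real.exp (-b * t ^ 2)) =
      ∫ t in Ioi Real.pi, Real.exp (-b * t ^ 2) := by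
    have := integral_comp_neg_Iic (-Real.pi) fun t : ℝ => Real.exp (-b * t ^ 2)
    simpa using this
  have h2 := intervalIntegral.integral_Iic_add_Ioi (b := -Real.pi) (f := fun t : ℝ =>
    Real.exp (-b * t ^ 2)) hint.integrableOn hint.integrableOn
  have h3 := intervalIntegral.integral_interval_add_Ioi (a := -Real.pi) (b := Real.pi)
    (f := fun t : ℝ => Real.exp (-b * t ^ 2)) hint.integrableOn hint.integrableOn
  have h4 := integral_gaussian b
  have h5 := integral_Ioi_pi_gaussian_le hb
  have h6 : 0 ≤ ∫ t in Ioi Real.pi, Real.exp (-b * t ^ 2) :=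
    MeasureTheory.integral_nonneg fun t => (Real.exp_pos _).le
  have h7 : 1 / b = 2 * (1 / (2 * b)) := by field_simp
  rw [h7, abs_le]
  constructor <;> linarith

open Complex in
/-- A local limit theorem: if `ψ` is close to the characteristic function of a centred Gaussian of
variance `V`, then its integral is close to that of the Gaussian. -/
theorem norm_integral_sub_sqrt_le {C V : ℝ} (hC : 0 ≤ C) (hV : 0 < V) {ψ : ℝ → ℂ}
    (hψ : Continuous ψ)
    (h : ∀ t, |t| ≤ Real.pi → ‖ψ t - cexp (-(V * t ^ 2 / 2))‖ ≤
      C * V * |t| ^ 3 * Real.exp (-(2 / Real.pi ^ 2 * V * t ^ 2))) :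
    ‖(∫ t in (-Real.pi)..Real.pi, ψ t) - (√(2 * Real.pi / V) : ℝ)‖ ≤
      (C * Real.pi ^ 4 / 4 + 2) / V := by
  have hpi := Real.pi_pos
  have hle : -Real.pi ≤ Real.pi := by linarith
  set b := 2 / Real.pi ^ 2 * V with hb
  have hb0 : 0 < b := by positivity
  have h1 : ∀ t : ℝ, cexp (-(V * t ^ 2 / 2)) = ((Real.exp (-(V / 2) * t ^ 2) : ℝ) : ℂ) := by
    intro t
    push_cast
    ring_nf
  have h2 := abs_integral_gaussian_sub_le (b := V / 2) (by positivity)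
  rw [show Real.pi / (V / 2) = 2 * Real.pi / V by field_simp] at h2
  obtain ⟨hint, hval⟩ := integral_abs_pow_three_mul_exp hb0
  -- The moment integral is `1 / b ^ 2` with `b = 2 V / π²`, so the factor `V` in the hypothesis
  -- leaves an error of order `1 / V`; the Gaussian tails contribute the remaining `2 / V`.
  have h3 : ‖∫ t in (-Real.pi)..Real.pi, (ψ t - cexp (-(V * t ^ 2 / 2)))‖ ≤
      C * Real.pi ^ 4 / 4 / V := by
    calc ‖∫ t in (-Real.pi)..Real.pi, (ψ t - cexp (-(V * t ^ 2 / 2)))‖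
        ≤ ∫ t in (-Real.pi)..Real.pi, C * V * (|t| ^ 3 * Real.exp (-b * t ^ 2)) := by
          refine intervalIntegral.norm_integral_le_of_norm_le hle ?_ ?_
          · refine Eventually.of_forall fun t ht => ?_
            have := h t (abs_le.mpr ⟨ht.1.le, ht.2⟩)
            refine this.trans (le_of_eq ?_)
            rw [neg_mul, mul_assoc (C * V)]
          · exact (hint.const_mul _).intervalIntegrable
      _ ≤ ∫ t, C * V * (|t| ^ 3 * Real.exp (-b * t ^ 2)) := by
          rw [intervalIntegral.integral_of_le hle]
          exact MeasureTheory.setIntegral_le_integral (hint.const_mul _)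
            (Eventually.of_forall fun t => by positivity)
      _ = C * Real.pi ^ 4 / 4 / V := by
          rw [MeasureTheory.integral_const_mul, hval, hb]
          field_simp
          norm_num
  have hcont : Continuous fun t : ℝ => cexp (-(V * t ^ 2 / 2)) := by fun_prop
  rw [intervalIntegral.integral_sub (hψ.intervalIntegrable _ _)
    (hcont.intervalIntegrable _ _)] at h3
  simp only [h1, intervalIntegral.integral_ofReal] at h3
  set G := ∫ t in (-Real.pi)..Real.pi, Real.exp (-(V / 2) * t ^ 2) with hG
  have h4 : ‖((G : ℝ) : ℂ) - (√(2 * Real.pi / V) : ℝ)‖ ≤ 1 / (V / 2) := by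
    rw [← ofReal_sub, norm_real, Real.norm_eq_abs]
    exact h2
  calc ‖(∫ t in (-Real.pi)..Real.pi, ψ t) - (√(2 * Real.pi / V) : ℝ)‖
      = ‖((∫ t in (-Real.pi)..Real.pi, ψ t) - (G : ℂ)) +
          ((G : ℂ) - (√(2 * Real.pi / V) : ℝ))‖ := by congr 1; ring
    _ ≤ C * Real.pi ^ 4 / 4 / V + 1 / (V / 2) := (norm_add_le _ _).trans (add_le_add h3 h4)
    _ = (C * Real.pi ^ 4 / 4 + 2) / V := by field_simp

/-! ### The Bernoulli factorisation of `sinh u / u` -/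

open Complex in
theorem tendsto_euler_sinh_prod {w : ℂ} (hw : w ≠ 0) :
    Tendsto (fun K : ℕ => ∏ k ∈ Finset.range K, (1 + w ^ 2 / (Real.pi ^ 2 * ((k : ℂ) + 1) ^ 2)))
      atTop (nhds (Complex.sinh w / w)) := by
  have hpi : (Real.pi : ℂ) ≠ 0 := by exact_mod_cast Real.pi_pos.ne'
  have h := Complex.tendsto_euler_sin_prod (w * I / Real.pi)
  have h1 : (Real.pi : ℂ) * (w * I / Real.pi) = w * I := by field_simp
  rw [h1, Complex.sin_mul_I] at h
  have h2 := h.const_mul (w * I)⁻¹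
  have hwI : w * I ≠ 0 := mul_ne_zero hw I_ne_zero
  have h3 : (w * I)⁻¹ * (Complex.sinh w * I) = Complex.sinh w / w := by
    field_simp
  rw [h3] at h2
  refine h2.congr fun K => ?_
  rw [inv_mul_cancel_left₀ hwI]
  refine Finset.prod_congr rfl fun k _ => ?_
  have : (w * I / Real.pi) ^ 2 = -(w ^ 2 / Real.pi ^ 2) := by
    rw [div_pow, mul_pow, I_sq]
    ring
  rw [this, neg_div, sub_neg_eq_add, div_div]

/-- The parameters of the Bernoulli variables in which `sinh u / u` factorises. -/
def sinhWeight (u : ℝ) (k : ℕ) : ℝ := u ^ 2 / (u ^ 2 + Real.pi ^ 2 * ((k : ℝ) + 1) ^ 2)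

theorem sinhWeight_nonneg (u : ℝ) (k : ℕ) : 0 ≤ sinhWeight u k := by
  unfold sinhWeight
  positivity

theorem sinhWeight_le_one (u : ℝ) (k : ℕ) : sinhWeight u k ≤ 1 :=
  div_le_one_of_le₀ (le_add_of_nonneg_right (by positivity)) (by positivity)

open Complex in
-- The partial fraction expansion of the cotangent at `i u / π`. It gives the mean, and so the
-- saddle point equation.
theorem hasSum_sinhWeight {u : ℝ} (hu : 0 < u) :
    HasSum (sinhWeight u) ((u * (Real.cosh u / Real.sinh u) - 1) / 2) := by
  have hpi : (Real.pi : ℂ) ≠ 0 := by exact_mod_cast Real.pi_pos.ne'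
  have hu0 : (u : ℂ) ≠ 0 := by exact_mod_cast hu.ne'
  have hs : Complex.sinh (u : ℂ) ≠ 0 := by
    rw [← ofReal_sinh]
    exact_mod_cast (Real.sinh_pos_iff.mpr hu).ne'
  set x : ℂ := u * I / Real.pi with hx
  have hxi : x = ((u / Real.pi : ℝ) : ℂ) * I := by rw [hx]; push_cast; ring
  have hxim : x.im ≠ 0 := by
    rw [hxi, im_ofReal_mul, I_im, mul_one]
    exact (div_pos hu Real.pi_pos).ne'
  have hxc : x ∈ integerComplement := by
    rw [mem_integerComplement_iff]
    rintro ⟨m, hm⟩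
    exact hxim (by rw [← hm]; simp)
  have h1 := (summable_cotTerm hxc).hasSum
  have h2 := cot_series_rep' hxc
  have h3 : (∑' n, cotTerm x n) = Real.pi * cot (Real.pi * x) - 1 / x := h2.symm
  rw [h3] at h1
  have h4 := h1.mul_right (u * I / (2 * Real.pi))
  rw [← Complex.hasSum_ofReal]
  have hterm : ∀ k : ℕ, cotTerm x k * (u * I / (2 * Real.pi)) = ((sinhWeight u k : ℝ) : ℂ) := by
    intro k
    have hden : (0 : ℝ) < u ^ 2 + Real.pi ^ 2 * ((k : ℝ) + 1) ^ 2 := by positivity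
    have hden' : ((u : ℂ) ^ 2 + Real.pi ^ 2 * ((k : ℂ) + 1) ^ 2) ≠ 0 := by
      exact_mod_cast hden.ne'
    have hm : x - ((k : ℂ) + 1) ≠ 0 := fun h =>
      hxim (by rw [sub_eq_zero.mp h]; simp)
    have hp : x + ((k : ℂ) + 1) ≠ 0 := fun h =>
      hxim (by rw [eq_neg_of_add_eq_zero_left h]; simp)
    have hprod : (x - ((k : ℂ) + 1)) * (x + ((k : ℂ) + 1)) =
        -((u : ℂ) ^ 2 + Real.pi ^ 2 * ((k : ℂ) + 1) ^ 2) / Real.pi ^ 2 := by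
      rw [eq_div_iff (pow_ne_zero 2 hpi), hx]
      field_simp
      linear_combination (u : ℂ) ^ 2 * I_sq
    have hsum : cotTerm x k = 2 * x / ((x - ((k : ℂ) + 1)) * (x + ((k : ℂ) + 1))) := by
      rw [cotTerm]
      field_simp
      ring
    rw [hsum, hprod, sinhWeight, hx]
    push_cast
    field_simp
    linear_combination -I_sq
  have hval : (Real.pi * cot (Real.pi * x) - 1 / x) * (u * I / (2 * Real.pi)) =
      (((u * (Real.cosh u / Real.sinh u) - 1) / 2 : ℝ) : ℂ) := by
    have hpx : (Real.pi : ℂ) * x = u * I := by rw [hx]; field_simp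
    rw [hpx, Complex.cot, Complex.cos_mul_I, Complex.sin_mul_I, hx]
    push_cast
    field_simp
  rw [hval] at h4
  rwa [funext hterm] at h4

theorem hasDerivAt_mul_coth {u : ℝ} (hu : 0 < u) :
    HasDerivAt (fun u => u * (Real.cosh u / Real.sinh u))
      (Real.cosh u / Real.sinh u - u / Real.sinh u ^ 2) u := by
  have hs : Real.sinh u ≠ 0 := (Real.sinh_pos_iff.mpr hu).ne'
  have h := (hasDerivAt_id u).mul ((Real.hasDerivAt_cosh u).div (Real.hasDerivAt_sinh u) hs)
  refine h.congr_deriv ?_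
  have h1 := Real.cosh_sq u
  simp only [id_eq, one_mul, Pi.div_apply]
  rw [show Real.sinh u * Real.sinh u - Real.cosh u * Real.cosh u = -1 by linarith]
  ring

/-- For each weight `p` one has `p (1 - p) = (u / 2) dp/du`, so the variance comes from
differentiating the series of `hasSum_sinhWeight` term by term. -/
theorem hasSum_sinhWeight_mul_one_sub {u : ℝ} (hu : 0 < u) :
    HasSum (fun k => sinhWeight u k * (1 - sinhWeight u k))
      ((u * (Real.cosh u / Real.sinh u) - u ^ 2 / Real.sinh u ^ 2) / 4) := by
  have hpi := Real.pi_pos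
  set c : ℕ → ℝ := fun k => Real.pi ^ 2 * ((k : ℝ) + 1) ^ 2 with hc
  have hc0 : ∀ k, 0 < c k := fun k => by rw [hc]; positivity
  have hsum : Summable fun k => 2 * (u + 1) / c k := by
    have h1 : Summable fun k : ℕ => 1 / ((k : ℝ) + 1) ^ 2 := by
      have := (summable_nat_add_iff 1).mpr (Real.summable_one_div_nat_pow.mpr (le_refl 2))
      simpa using this
    refine (h1.mul_left (2 * (u + 1) / Real.pi ^ 2)).congr fun k => ?_
    rw [hc]
    field_simp
  have hd : ∀ (k : ℕ), ∀ y ∈ Ioo 0 (u + 1), HasDerivAt (fun y => sinhWeight y k)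
      (2 * y * c k / (y ^ 2 + c k) ^ 2) y := by
    intro k y hy
    have hy0 := hy.1
    have hck := hc0 k
    have hden : y ^ 2 + c k ≠ 0 := by positivity
    have h := (hasDerivAt_pow 2 y).div ((hasDerivAt_pow 2 y).add_const (c k)) hden
    refine h.congr_deriv ?_
    congr 1
    push_cast
    ring
  have hb : ∀ (k : ℕ), ∀ y ∈ Ioo 0 (u + 1),
      ‖2 * y * c k / (y ^ 2 + c k) ^ 2‖ ≤ 2 * (u + 1) / c k := by
    intro k y hy
    have hy0 := hy.1
    have hck := hc0 k
    rw [Real.norm_eq_abs, abs_of_nonneg (by positivity), div_le_div_iff₀ (by positivity) hck]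
    have h1 : c k ^ 2 ≤ (y ^ 2 + c k) ^ 2 :=
      pow_le_pow_left₀ hck.le (le_add_of_nonneg_left (sq_nonneg y)) 2
    calc 2 * y * c k * c k = 2 * y * c k ^ 2 := by ring
      _ ≤ 2 * (u + 1) * (y ^ 2 + c k) ^ 2 := by
        have := hy.2.le
        gcongr
  have hmem : u ∈ Ioo 0 (u + 1) := ⟨hu, by linarith⟩
  have hder := hasDerivAt_tsum_of_isPreconnected hsum isOpen_Ioo isPreconnected_Ioo hd hb hmem
    (hasSum_sinhWeight hu).summable hmem
  have heq : (fun z => ∑' k, sinhWeight z k) =ᶠ[nhds u]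
      fun z => (z * (Real.cosh z / Real.sinh z) - 1) / 2 := by
    filter_upwards [lt_mem_nhds hu] with z hz
    exact (hasSum_sinhWeight hz).tsum_eq
  have hder2 := ((hasDerivAt_mul_coth hu).sub_const 1).div_const 2
  have hval := (hder.congr_of_eventuallyEq heq.symm).unique hder2
  have hsummable : Summable fun k => 2 * u * c k / (u ^ 2 + c k) ^ 2 :=
    Summable.of_norm_bounded hsum fun k => hb k u hmem
  have hS := (hval ▸ hsummable.hasSum).mul_left (u / 2)
  have h1 : u / 2 * ((Real.cosh u / Real.sinh u - u / Real.sinh u ^ 2) / 2) =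
      (u * (Real.cosh u / Real.sinh u) - u ^ 2 / Real.sinh u ^ 2) / 4 := by ring
  rw [h1] at hS
  have hterm : ∀ k, u / 2 * (2 * u * c k / (u ^ 2 + c k) ^ 2) =
      sinhWeight u k * (1 - sinhWeight u k) := by
    intro k
    have hck := hc0 k
    have : sinhWeight u k = u ^ 2 / (u ^ 2 + c k) := rfl
    rw [this]
    field_simp
    ring
  rwa [funext hterm] at hS

/-- The characteristic function of the sum of Bernoulli variables attached to
`(sinh u / u) ^ (2 n)`, centred at `g`. -/
def sinhChar (n g : ℕ) (u t : ℝ) : ℂ :=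
  (Complex.sinh (u * Complex.exp (t / 2 * Complex.I)) / (u * Complex.exp (t / 2 * Complex.I)) /
    (Real.sinh u / u : ℝ)) ^ (2 * n) * Complex.exp (-(g * t * Complex.I))

theorem continuous_sinhChar (n g : ℕ) {u : ℝ} (hu : 0 < u) : Continuous (sinhChar n g u) := by
  have h1 : ∀ t : ℝ, (u : ℂ) * Complex.exp (t / 2 * Complex.I) ≠ 0 := fun t =>
    mul_ne_zero (by exact_mod_cast hu.ne') (Complex.exp_ne_zero _)
  have h2 : Continuous fun t : ℝ => (u : ℂ) * Complex.exp (t / 2 * Complex.I) := by fun_prop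
  unfold sinhChar
  exact ((((Complex.continuous_sinh.comp h2).div h2 h1).div_const _).pow _).mul (by fun_prop)

open Complex in
-- With `w = u exp (i t / 2)` the factor of Euler's product at `w`, divided by that at `u`, is `1 -
-- p + p exp (i t)` with `p = sinhWeight u k`. Each weight occurs `2 n` times, and the total mean is
-- `g` by the saddle point equation.
theorem tendsto_prod_bernoulliChar (n g : ℕ) {u : ℝ} (hu : 0 < u)
    (hg : (n : ℝ) * (u * (Real.cosh u / Real.sinh u) - 1) = g) (t : ℝ) :
    Tendsto (fun K : ℕ => ∏ i ∈ Finset.range K ×ˢ Finset.range (2 * n),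
      bernoulliChar (sinhWeight u i.1) t) atTop (nhds (sinhChar n g u t)) := by
  have hu0 : (u : ℂ) ≠ 0 := by exact_mod_cast hu.ne'
  set w : ℂ := u * cexp (t / 2 * I) with hw
  have hw0 : w ≠ 0 := mul_ne_zero hu0 (Complex.exp_ne_zero _)
  have hs : Real.sinh u / u ≠ 0 := (div_pos (Real.sinh_pos_iff.mpr hu) hu).ne'
  have h1 := tendsto_euler_sinh_prod hw0
  have h2 := tendsto_euler_sinh_prod hu0
  have hsu : Complex.sinh (u : ℂ) / u = ((Real.sinh u / u : ℝ) : ℂ) := by push_cast; rfl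
  rw [hsu] at h2
  have h3 := (h1.div h2 (by exact_mod_cast hs)).pow (2 * n)
  have hmean : Tendsto (fun K : ℕ => ((∑ k ∈ Finset.range K, sinhWeight u k : ℝ) : ℂ)) atTop
      (nhds (((u * (Real.cosh u / Real.sinh u) - 1) / 2 : ℝ) : ℂ)) :=
    (continuous_ofReal.tendsto _).comp (hasSum_sinhWeight hu).tendsto_sum_nat
  have h4 : Tendsto (fun K : ℕ =>
      cexp (-(2 * n * ((∑ k ∈ Finset.range K, sinhWeight u k : ℝ) : ℂ) * t * I))) atTop
      (nhds (cexp (-(2 * n * (((u * (Real.cosh u / Real.sinh u) - 1) / 2 : ℝ) : ℂ) * t * I)))) :=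
    (Complex.continuous_exp.tendsto _).comp
      ((((hmean.const_mul (2 * (n : ℂ))).mul_const _).mul_const _).neg)
  have h5 : (2 * n * (((u * (Real.cosh u / Real.sinh u) - 1) / 2 : ℝ) : ℂ)) = g := by
    rw [← ofReal_natCast g, ← hg]
    push_cast
    ring
  rw [h5] at h4
  refine (h3.mul h4).congr fun K => ?_
  rw [Finset.prod_product]
  simp only [Finset.prod_const, Finset.card_range]
  rw [Finset.prod_pow]
  have h6 : cexp (-(2 * n * ((∑ k ∈ Finset.range K, sinhWeight u k : ℝ) : ℂ) * t * I)) =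
      (∏ k ∈ Finset.range K, cexp (-(sinhWeight u k * t * I))) ^ (2 * n) := by
    rw [← Complex.exp_sum, ← Complex.exp_nat_mul]
    congr 1
    rw [Finset.sum_neg_distrib]
    push_cast
    rw [← Finset.sum_mul, ← Finset.sum_mul]
    ring
  rw [h6, Pi.div_apply, ← Finset.prod_div_distrib, ← mul_pow, ← Finset.prod_mul_distrib]
  congr 1
  refine Finset.prod_congr rfl fun k _ => ?_
  rw [bernoulliChar]
  congr 1
  have hw2 : w ^ 2 = u ^ 2 * cexp (t * I) := by
    rw [hw, mul_pow, ← Complex.exp_nat_mul]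
    congr 2
    push_cast
    ring
  have hden : (0 : ℝ) < u ^ 2 + Real.pi ^ 2 * ((k : ℝ) + 1) ^ 2 := by positivity
  have hden' : ((u : ℂ) ^ 2 + Real.pi ^ 2 * ((k : ℂ) + 1) ^ 2) ≠ 0 := by
    exact_mod_cast hden.ne'
  have hc : (Real.pi : ℂ) ^ 2 * ((k : ℂ) + 1) ^ 2 ≠ 0 := by
    have : (0 : ℝ) < Real.pi ^ 2 * ((k : ℝ) + 1) ^ 2 := by positivity
    exact_mod_cast this.ne'
  rw [hw2, sinhWeight]
  push_cast
  set C : ℂ := (Real.pi : ℂ) ^ 2 * ((k : ℂ) + 1) ^ 2 with hC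
  have hCu : 1 + (u : ℂ) ^ 2 / C ≠ 0 := by
    rw [one_add_div hc, add_comm]
    exact div_ne_zero hden' hc
  rw [div_eq_iff hCu]
  field_simp
  ring

/-- The variance attached to `(sinh u / u) ^ (2 n)`. -/
def sinhVariance (n : ℕ) (u : ℝ) : ℝ :=
  n / 2 * (u * (Real.cosh u / Real.sinh u) - u ^ 2 / Real.sinh u ^ 2)

open Complex in
-- The bound for finite products depends continuously on the variance alone, so it survives the
-- passage to the infinite product.
theorem norm_sinhChar_sub_le (n g : ℕ) {u : ℝ} (hu : 0 < u)
    (hg : (n : ℝ) * (u * (Real.cosh u / Real.sinh u) - 1) = g) {t : ℝ} (ht : |t| ≤ Real.pi) :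
    ‖sinhChar n g u t - cexp (-(sinhVariance n u * t ^ 2 / 2))‖ ≤
      2 * Real.exp Real.pi * Real.exp (1 / 2) * sinhVariance n u * |t| ^ 3 *
        Real.exp (-(2 / Real.pi ^ 2 * sinhVariance n u * t ^ 2)) := by
  have h1 := tendsto_prod_bernoulliChar n g hu hg t
  have hV : Tendsto (fun K : ℕ => ∑ i ∈ Finset.range K ×ˢ Finset.range (2 * n),
      sinhWeight u i.1 * (1 - sinhWeight u i.1)) atTop (nhds (sinhVariance n u)) := by
    have h2 := (hasSum_sinhWeight_mul_one_sub hu).tendsto_sum_nat.const_mul (2 * (n : ℝ))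
    have h3 : 2 * (n : ℝ) * ((u * (Real.cosh u / Real.sinh u) - u ^ 2 / Real.sinh u ^ 2) / 4) =
        sinhVariance n u := by
      rw [sinhVariance]; ring
    rw [h3] at h2
    refine h2.congr fun K => ?_
    rw [Finset.sum_product, Finset.mul_sum]
    refine Finset.sum_congr rfl fun k _ => ?_
    simp only [Finset.sum_const, Finset.card_range, nsmul_eq_mul]
    push_cast
    rfl
  have hcont : Continuous fun V : ℝ => cexp (-((V : ℝ) * t ^ 2 / 2)) := by fun_prop
  have hcont2 : Continuous fun V : ℝ => 2 * Real.exp Real.pi * Real.exp (1 / 2) * V * |t| ^ 3 *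
        Real.exp (-(2 / Real.pi ^ 2 * V * t ^ 2)) := by fun_prop
  refine le_of_tendsto_of_tendsto (h1.sub ((hcont.tendsto _).comp hV)).norm
    ((hcont2.tendsto _).comp hV) (Eventually.of_forall fun K => ?_)
  exact norm_prod_bernoulliChar_sub_le _ (fun i : ℕ × ℕ => sinhWeight u i.1) ht
    (fun i => sinhWeight_nonneg u i.1) (fun i => sinhWeight_le_one u i.1)

open Complex in
theorem integral_sinhChar (n g : ℕ) {u : ℝ} (hu : 0 < u) :
    ∫ t in (-Real.pi)..Real.pi, sinhChar n g u t =
      ((((2 * n).factorial : ℝ) * centralFactorial n g * (2 * u) ^ (2 * (n + g)) /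
        ((2 * (n + g)).factorial : ℝ) * (2 * Real.pi) / (2 * Real.sinh u) ^ (2 * n) : ℝ) : ℂ) := by
  have hu0 : (u : ℂ) ≠ 0 := by exact_mod_cast hu.ne'
  have hs : Complex.sinh (u : ℂ) ≠ 0 := by
    rw [← ofReal_sinh]
    exact_mod_cast (Real.sinh_pos_iff.mpr hu).ne'
  -- A shift by `2 π` changes the sign of `exp (i t / 2)`, and `sinh w / w` is even.
  have hper : Function.Periodic (sinhChar n g u) (2 * Real.pi) := by
    intro t
    have h1 : cexp (((t + 2 * Real.pi : ℝ) : ℂ) / 2 * I) = -cexp (t / 2 * I) := by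
      rw [show (((t + 2 * Real.pi : ℝ) : ℂ) / 2 * I) = t / 2 * I + Real.pi * I by
        push_cast; ring, Complex.exp_add, exp_pi_mul_I]
      ring
    have h2 : cexp (-(g * ((t + 2 * Real.pi : ℝ) : ℂ) * I)) = cexp (-(g * t * I)) := by
      rw [Complex.exp_eq_exp_iff_exists_int]
      exact ⟨-g, by push_cast; ring⟩
    rw [sinhChar, sinhChar, h1, h2, mul_neg, Complex.sinh_neg, neg_div_neg_eq]
  have hint : ∀ a b : ℝ, IntervalIntegrable (sinhChar n g u) MeasureTheory.volume a b :=
    fun a b => (continuous_sinhChar n g hu).intervalIntegrable a b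
  -- The circle in Cauchy's formula runs through the period of `sinhChar` twice, because only even
  -- powers occur.
  have h1 : ∫ t in (-Real.pi)..Real.pi, sinhChar n g u (2 * t) =
      ∫ t in (-Real.pi)..Real.pi, sinhChar n g u t := by
    rw [intervalIntegral.integral_comp_mul_left _ two_ne_zero]
    have h2 := hper.intervalIntegral_add_zsmul_eq 2 (2 * -Real.pi) hint
    rw [show 2 * -Real.pi + (2 : ℤ) • (2 * Real.pi) = 2 * Real.pi by
      rw [zsmul_eq_mul]; push_cast; ring,
      hper.intervalIntegral_add_eq (2 * -Real.pi) (-Real.pi),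
      show -Real.pi + 2 * Real.pi = Real.pi by ring] at h2
    rw [h2]
    simp [zsmul_eq_mul]
  have h3 := centralFactorial_eq_integral n g u
  rw [← h1]
  have h4 : ∀ t : ℝ, (2 * Complex.sinh (u * cexp (t * I))) ^ (2 * n) *
      cexp (-((2 * (n + g) : ℕ) * t * I)) =
      (2 * Complex.sinh u) ^ (2 * n) * sinhChar n g u (2 * t) := by
    intro t
    have h5 : ((2 * t : ℝ) : ℂ) / 2 * I = t * I := by push_cast; ring
    have h6 : cexp (-((2 * (n + g) : ℕ) * t * I)) =
        (cexp (t * I) ^ (2 * n))⁻¹ * cexp (-(g * ((2 * t : ℝ) : ℂ) * I)) := by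
      rw [← Complex.exp_nat_mul, ← Complex.exp_neg, ← Complex.exp_add]
      congr 1
      push_cast
      ring
    have he := Complex.exp_ne_zero (t * I)
    have h7 : 2 * Complex.sinh (u * cexp (t * I)) = 2 * Complex.sinh u *
        (Complex.sinh (u * cexp (t * I)) / (u * cexp (t * I)) / (Real.sinh u / u : ℝ)) *
        cexp (t * I) := by
      push_cast
      field_simp
    rw [sinhChar, h5, h6, h7, mul_pow _ (cexp (t * I)), mul_pow, mul_assoc (_ * _) (_ ^ (2 * n)),
      mul_inv_cancel_left₀ (pow_ne_zero _ he), mul_assoc]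
  simp only [h4] at h3
  rw [intervalIntegral.integral_const_mul] at h3
  rw [ofReal_div, h3]
  push_cast
  rw [mul_div_cancel_left₀]
  exact pow_ne_zero _ (mul_ne_zero two_ne_zero hs)

/-- Central factorial numbers by the saddle point method, with a uniform error term. -/
theorem abs_centralFactorial_sub_le (n g : ℕ) {u : ℝ} (hu : 0 < u) (hV : 0 < sinhVariance n u)
    (hg : (n : ℝ) * (u * (Real.cosh u / Real.sinh u) - 1) = g) :
    |((2 * n).factorial : ℝ) * centralFactorial n g * (2 * u) ^ (2 * (n + g)) /
        ((2 * (n + g)).factorial : ℝ) * (2 * Real.pi) / (2 * Real.sinh u) ^ (2 * n) -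
        √(2 * Real.pi / sinhVariance n u)| ≤
      (2 * Real.exp Real.pi * Real.exp (1 / 2) * Real.pi ^ 4 / 4 + 2) / sinhVariance n u := by
  have h := norm_integral_sub_sqrt_le (C := 2 * Real.exp Real.pi * Real.exp (1 / 2))
    (by positivity) hV (continuous_sinhChar n g hu)
    (fun t ht => norm_sinhChar_sub_le n g hu hg ht)
  rw [integral_sinhChar n g hu, ← Complex.ofReal_sub, Complex.norm_real, Real.norm_eq_abs] at h
  exact h

/-! ### The parametrisation by the saddle point -/

/-- The function `θ` in the parametrisation `x = 1 / (4 cosh² u)`. -/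
def cothTheta (u : ℝ) : ℝ := u * (Real.cosh u / Real.sinh u) - 1

theorem one_div_four_mul_cosh_sq_mem {u : ℝ} (hu : 0 < u) :
    1 / (4 * Real.cosh u ^ 2) ∈ Ioo (0 : ℝ) (1 / 4) := by
  have h1 : 1 < Real.cosh u := Real.one_lt_cosh.mpr hu.ne'
  refine ⟨by positivity, ?_⟩
  rw [div_lt_div_iff₀ (by positivity) (by norm_num)]
  nlinarith

theorem one_sub_four_mul_eq {u : ℝ} :
    1 - 4 * (1 / (4 * Real.cosh u ^ 2)) = (Real.sinh u / Real.cosh u) ^ 2 := by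
  have h1 := Real.cosh_pos u
  have h2 := Real.cosh_sq u
  field_simp
  linarith

theorem theta_one_div {u : ℝ} (hu : 0 < u) :
    theta (1 / (4 * Real.cosh u ^ 2)) = cothTheta u := by
  have hs := Real.sinh_pos_iff.mpr hu
  have hc := Real.cosh_pos u
  rw [theta, if_neg (one_div_four_mul_cosh_sq_mem hu).2.ne, one_sub_four_mul_eq,
    Real.sqrt_sq (by positivity), ← Real.tanh_eq_sinh_div_cosh, Real.artanh_tanh, cothTheta,
    Real.tanh_eq_sinh_div_cosh]
  field_simp
  ring

theorem exists_eq_one_div {x : ℝ} (hx : x ∈ Ioo (0 : ℝ) (1 / 4)) :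
    ∃ u, 0 < u ∧ x = 1 / (4 * Real.cosh u ^ 2) := by
  have h0 : 0 < 1 - 4 * x := by linarith [hx.2]
  have h1 : 1 - 4 * x < 1 := by linarith [hx.1]
  have hmem : √(1 - 4 * x) ∈ Ioo (0 : ℝ) 1 :=
    ⟨Real.sqrt_pos.mpr h0, by rw [Real.sqrt_lt' one_pos]; linarith⟩
  refine ⟨Real.artanh √(1 - 4 * x), Real.artanh_pos hmem, ?_⟩
  have hx0 := hx.1
  rw [Real.cosh_artanh ⟨by linarith [hmem.1], hmem.2⟩, Real.sq_sqrt h0.le, div_pow,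
    Real.sq_sqrt (by linarith)]
  field_simp
  ring

theorem lt_sinh_mul_cosh {u : ℝ} (hu : 0 < u) : u < Real.sinh u * Real.cosh u := by
  have h1 : u < Real.sinh u := Real.self_lt_sinh_iff.mpr hu
  have h2 := Real.one_le_cosh u
  nlinarith

theorem continuousOn_cothTheta : ContinuousOn cothTheta (Ioi 0) := fun _ hu =>
  ((hasDerivAt_mul_coth hu).sub_const 1).continuousAt.continuousWithinAt

theorem strictMonoOn_cothTheta : StrictMonoOn cothTheta (Ioi 0) := by
  refine strictMonoOn_of_deriv_pos (convex_Ioi 0) continuousOn_cothTheta fun u hu => ?_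
  rw [interior_Ioi] at hu
  have hu : 0 < u := hu
  have hs := Real.sinh_pos_iff.mpr hu
  have h := ((hasDerivAt_mul_coth hu).sub_const 1).deriv
  change 0 < deriv (fun u => u * (Real.cosh u / Real.sinh u) - 1) u
  rw [h]
  have : Real.cosh u / Real.sinh u - u / Real.sinh u ^ 2 =
      (Real.sinh u * Real.cosh u - u) / Real.sinh u ^ 2 := by
    field_simp
  rw [this]
  exact div_pos (sub_pos.mpr (lt_sinh_mul_cosh hu)) (by positivity)

theorem cothTheta_le {u : ℝ} (hu : 0 < u) : cothTheta u ≤ Real.cosh u - 1 := by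
  have hs := Real.sinh_pos_iff.mpr hu
  have h1 : u < Real.sinh u := Real.self_lt_sinh_iff.mpr hu
  have h2 : u * (Real.cosh u / Real.sinh u) ≤ Real.cosh u := by
    rw [← mul_div_assoc, div_le_iff₀ hs]
    nlinarith [Real.cosh_pos u]
  rw [cothTheta]
  linarith

theorem le_cothTheta {u : ℝ} (hu : 0 < u) : u - 1 ≤ cothTheta u := by
  have hs := Real.sinh_pos_iff.mpr hu
  have h2 : 1 ≤ Real.cosh u / Real.sinh u := by
    rw [one_le_div hs]
    exact (Real.sinh_lt_cosh u).le
  rw [cothTheta]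
  nlinarith

/-- Half of this quantity is a sum of positive Bernoulli weights. -/
theorem cothTheta_pos {u : ℝ} (hu : 0 < u) : 0 < cothTheta u := by
  have h1 := le_hasSum (hasSum_sinhWeight hu) 0 fun k _ => sinhWeight_nonneg u k
  have h2 : 0 < sinhWeight u 0 := by
    unfold sinhWeight
    positivity
  rw [cothTheta]
  linarith

/-- The bounds `u - 1 ≤ cothTheta u ≤ cosh u - 1` supply the end points for the intermediate value
theorem. -/
theorem exists_cothTheta_eq {y : ℝ} (hy : 0 < y) : ∃ u, 0 < u ∧ cothTheta u = y := by
  obtain ⟨a, ha0, ha⟩ : ∃ a, 0 < a ∧ Real.cosh a < 1 + y := by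
    have h1 : ∀ᶠ a in nhds (0 : ℝ), Real.cosh a < 1 + y := by
      refine Real.continuous_cosh.continuousAt.eventually_lt continuousAt_const ?_
      rw [Real.cosh_zero]
      linarith
    obtain ⟨a, h2, h3⟩ := ((h1.filter_mono nhdsWithin_le_nhds).and
      (self_mem_nhdsWithin (s := Ioi (0 : ℝ)))).exists
    exact ⟨a, h3, h2⟩
  have hb0 : 0 < y + 1 := by linarith
  have hmem : y ∈ Icc (cothTheta a) (cothTheta (y + 1)) :=
    ⟨by linarith [cothTheta_le ha0], by linarith [le_cothTheta hb0]⟩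
  obtain ⟨u, hu, hu'⟩ := isPreconnected_Ioi.intermediate_value (mem_Ioi.mpr ha0) (mem_Ioi.mpr hb0)
    continuousOn_cothTheta hmem
  exact ⟨u, hu, hu'⟩

theorem bijOn_theta : BijOn theta (Ioc 0 (1 / 4)) (Ici 0) := by
  have hquarter : theta (1 / 4) = 0 := by rw [theta, if_pos rfl]
  refine ⟨fun x hx => ?_, fun x hx y hy hxy => ?_, fun y hy => ?_⟩
  · rcases hx.2.eq_or_lt with h | h
    · rw [h, hquarter]
      exact self_mem_Ici
    · obtain ⟨u, hu, rfl⟩ := exists_eq_one_div ⟨hx.1, h⟩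
      rw [theta_one_div hu]
      exact (cothTheta_pos hu).le
  · rcases hx.2.eq_or_lt with h | h <;> rcases hy.2.eq_or_lt with h' | h'
    · rw [h, h']
    · obtain ⟨u, hu, rfl⟩ := exists_eq_one_div ⟨hy.1, h'⟩
      rw [h, hquarter, theta_one_div hu] at hxy
      exact absurd hxy (cothTheta_pos hu).ne
    · obtain ⟨u, hu, rfl⟩ := exists_eq_one_div ⟨hx.1, h⟩
      rw [h', hquarter, theta_one_div hu] at hxy
      exact absurd hxy (cothTheta_pos hu).ne'
    · obtain ⟨u, hu, rfl⟩ := exists_eq_one_div ⟨hx.1, h⟩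
      obtain ⟨v, hv, rfl⟩ := exists_eq_one_div ⟨hy.1, h'⟩
      rw [theta_one_div hu, theta_one_div hv] at hxy
      rw [strictMonoOn_cothTheta.injOn hu hv hxy]
  · rcases (Set.mem_Ici.mp hy).eq_or_lt with h | h
    · exact ⟨1 / 4, ⟨by norm_num, le_rfl⟩, by rw [hquarter, h]⟩
    · obtain ⟨u, hu, rfl⟩ := exists_cothTheta_eq h
      have := one_div_four_mul_cosh_sq_mem hu
      exact ⟨_, ⟨this.1, this.2.le⟩, theta_one_div hu⟩

theorem lam_cothTheta {u : ℝ} (hu : 0 < u) : lam (cothTheta u) = 1 / (4 * Real.cosh u ^ 2) := by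
  rw [← theta_one_div hu, lam]
  have := one_div_four_mul_cosh_sq_mem hu
  exact bijOn_theta.injOn.leftInvOn_invFunOn ⟨this.1, this.2.le⟩

/-- The argument of the logarithm in `j`, in the parametrisation by `u`. -/
def jArg (u : ℝ) : ℝ := 1 - u / (Real.sinh u * Real.cosh u)

theorem jArg_pos {u : ℝ} (hu : 0 < u) : 0 < jArg u := by
  have hs := Real.sinh_pos_iff.mpr hu
  have hc := Real.cosh_pos u
  rw [jArg, sub_pos, div_lt_one (by positivity)]
  exact lt_sinh_mul_cosh hu

theorem jArg_eq {u : ℝ} (hu : 0 < u) :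
    1 - 4 * (cothTheta u + 1) * lam (cothTheta u) = jArg u := by
  have hs := Real.sinh_pos_iff.mpr hu
  have hc := Real.cosh_pos u
  rw [lam_cothTheta hu, cothTheta, jArg]
  field_simp
  ring

theorem one_sub_pos {t : ℝ} (ht : 0 < t) : 0 < 1 - 4 * (t + 1) * lam t := by
  obtain ⟨u, hu, rfl⟩ := exists_cothTheta_eq ht
  rw [jArg_eq hu]
  exact jArg_pos hu

theorem exp_j {u : ℝ} (hu : 0 < u) : Real.exp (j (cothTheta u)) = 2 / √(jArg u) := by
  have hD := jArg_pos hu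
  rw [j, jArg_eq hu, Real.exp_add, Real.exp_log two_pos, neg_div, Real.exp_neg,
    ← Real.log_sqrt hD.le, Real.exp_log (Real.sqrt_pos.mpr hD)]
  ring

theorem exp_mul_f {n g : ℕ} {u : ℝ} (hu : 0 < u) (hg : (n : ℝ) * cothTheta u = g) :
    Real.exp (n * f (cothTheta u)) = (4 * Real.cosh u ^ 2) ^ n * (Real.exp 1 ^ (2 * g))⁻¹ *
      (Real.cosh u / Real.sinh u) ^ (2 * g) := by
  have hs := Real.sinh_pos_iff.mpr hu
  have hc := Real.cosh_pos u
  have h1 : (n : ℝ) * f (cothTheta u) = n * Real.log (4 * Real.cosh u ^ 2) +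
      -((2 * g : ℕ) * 1) + (2 * g : ℕ) * Real.log (Real.cosh u / Real.sinh u) := by
    have h2 : Real.log (Real.cosh u / Real.sinh u) = -Real.log (Real.sinh u / Real.cosh u) := by
      rw [← Real.log_inv, inv_div]
    rw [f, lam_cothTheta hu, one_sub_four_mul_eq, Real.log_pow, one_div, Real.log_inv, h2]
    push_cast
    rw [← hg]
    ring
  rw [h1, Real.exp_add, Real.exp_add, Real.exp_neg, Real.exp_nat_mul, Real.exp_nat_mul,
    Real.exp_nat_mul, Real.exp_log (by positivity), Real.exp_log (by positivity)]

theorem Omega_eq {n g : ℕ} (hn : 1 ≤ n) (hg1 : 1 ≤ g) {u : ℝ} (hu : 0 < u)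
    (hg : (n : ℝ) * cothTheta u = g) :
    Omega n g = √(g : ℝ) * (g : ℝ) ^ g / (√(2 * Real.pi) * Real.exp 1 ^ g * (g.factorial : ℝ)) *
      ((n : ℝ) ^ (2 * g) / (n : ℝ) ^ 2) *
      ((4 * Real.cosh u ^ 2) ^ n * (Real.exp 1 ^ (2 * g))⁻¹ *
        (Real.cosh u / Real.sinh u) ^ (2 * g) * (2 / √(jArg u))) := by
  have hn0 : (n : ℝ) ≠ 0 := by
    have : n ≠ 0 := by lia
    exact_mod_cast this
  have h1 : (g : ℝ) / n = cothTheta u := by rw [← hg]; field_simp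
  rw [Omega, if_neg (by lia), h1, Real.exp_add, exp_mul_f hu hg, exp_j hu,
    zpow_sub₀ hn0, ← Real.exp_nat_mul 1 g, mul_one]
  congr 2

/-! ### Comparison with `Omega` when `n` and `g` are both large -/

/-- The ratio of the factorial to Stirling's approximation. -/
def stirlingRatio (k : ℕ) : ℝ :=
  (k.factorial : ℝ) / (√(2 * k * Real.pi) * (k / Real.exp 1) ^ k)

theorem tendsto_stirlingRatio : Tendsto stirlingRatio atTop (nhds 1) := by
  refine (isEquivalent_iff_tendsto_one ?_).mp Stirling.factorial_isEquivalent_stirling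
  filter_upwards [eventually_ge_atTop 1] with k hk
  have : (0 : ℝ) < k := by exact_mod_cast hk
  positivity

theorem factorial_eq_stirlingRatio_mul {k : ℕ} (hk : 1 ≤ k) : (k.factorial : ℝ) =
    stirlingRatio k * (√(2 * k * Real.pi) * (k / Real.exp 1) ^ k) := by
  have : (0 : ℝ) < k := by exact_mod_cast hk
  rw [stirlingRatio, div_mul_cancel₀]
  positivity

theorem stirlingRatio_pos {k : ℕ} (hk : 1 ≤ k) : 0 < stirlingRatio k := by
  have : (0 : ℝ) < k := by exact_mod_cast hk
  rw [stirlingRatio]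
  positivity

/-- At the saddle point `n u coth u = n + g`, so `exp j` is, up to elementary factors, the Gaussian
prefactor `1 / √V`. -/
theorem sinhVariance_eq (n : ℕ) {u : ℝ} (hu : 0 < u) :
    sinhVariance n u = n * (u * (Real.cosh u / Real.sinh u)) / 2 * jArg u := by
  have hs := Real.sinh_pos_iff.mpr hu
  have hc := Real.cosh_pos u
  rw [sinhVariance, jArg]
  field_simp

theorem half_le_sinhVariance {n g : ℕ} {u : ℝ} (hu : 0 < u)
    (hg : (n : ℝ) * cothTheta u = g) : (g : ℝ) / 2 ≤ sinhVariance n u := by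
  have h1 : u < Real.sinh u := Real.self_lt_sinh_iff.mpr hu
  have h2 : u ^ 2 / Real.sinh u ^ 2 ≤ 1 := by
    rw [div_le_one (by positivity)]
    gcongr
  rw [sinhVariance, ← hg, cothTheta]
  have : (0 : ℝ) ≤ n := n.cast_nonneg
  nlinarith

theorem centralBinom_eq_div (n : ℕ) :
    (n.centralBinom : ℝ) = ((2 * n).factorial : ℝ) / (n.factorial : ℝ) ^ 2 := by
  have h := Nat.choose_mul_factorial_mul_factorial (show n ≤ 2 * n by lia)
  rw [show 2 * n - n = n by lia] at h
  rw [eq_div_iff (by positivity), Nat.centralBinom, sq, ← mul_assoc]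
  exact_mod_cast h

/-- The factor by which `E / Ω` differs from the local limit estimate. -/
def stirlingFactor (n g : ℕ) : ℝ :=
  stirlingRatio (2 * (n + g)) * stirlingRatio g / stirlingRatio n ^ 2 * (n / (n + 1))

/-- An exact identity: all factorials are replaced by Stirling's expression times its ratio, and the
bracket is the quantity that the local limit theorem shows to be near `√(2 π / V)`. -/
theorem E_eq_mul_Omega {n g : ℕ} (hn : 1 ≤ n) (hg1 : 1 ≤ g) {u : ℝ} (hu : 0 < u)
    (hg : (n : ℝ) * cothTheta u = g) :
    E n g = stirlingFactor n g * (√(sinhVariance n u / (2 * Real.pi)) *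
      (((2 * n).factorial : ℝ) * centralFactorial n g * (2 * u) ^ (2 * (n + g)) /
        ((2 * (n + g)).factorial : ℝ) * (2 * Real.pi) / (2 * Real.sinh u) ^ (2 * n))) *
      Omega n g := by
  have hs := Real.sinh_pos_iff.mpr hu
  have hc := Real.cosh_pos u
  have hpi := Real.pi_pos
  have hn0 : (0 : ℝ) < n := by exact_mod_cast hn
  have hg0 : (0 : ℝ) < g := by exact_mod_cast hg1
  have hD := jArg_pos hu
  have hfn := factorial_eq_stirlingRatio_mul hn
  have hfg := factorial_eq_stirlingRatio_mul hg1
  have hfN := factorial_eq_stirlingRatio_mul (k := 2 * (n + g)) (by lia)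
  have hSn := stirlingRatio_pos hn
  have hSg := stirlingRatio_pos hg1
  have hSN := stirlingRatio_pos (k := 2 * (n + g)) (by lia)
  have hN : (n : ℝ) + g = n * (u * (Real.cosh u / Real.sinh u)) := by
    rw [← hg, cothTheta]; ring
  rw [E_eq hn, Omega_eq hn hg1 hu hg, centralBinom_eq_div, stirlingFactor]
  set A := centralFactorial n g with hA
  set e := Real.exp 1 with he
  have he0 : 0 < e := Real.exp_pos 1
  have hroot : √(2 * ((2 * (n + g) : ℕ) : ℝ) * Real.pi) * √(jArg u) =
      2 * √(2 * Real.pi) * √(2 * Real.pi) * √(sinhVariance n u / (2 * Real.pi)) := by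
    rw [mul_assoc 2 √(2 * Real.pi), Real.mul_self_sqrt (by positivity), ← Real.sqrt_mul
      (by positivity), sinhVariance_eq n hu, ← hN]
    rw [show 2 * (2 * Real.pi) = √((2 * (2 * Real.pi)) ^ 2) by
      rw [Real.sqrt_sq (by positivity)], ← Real.sqrt_mul (by positivity)]
    congr 1
    push_cast
    field_simp
  -- The saddle point equation turns `2 (n + g)` into `2 n u coth u`; this matches the powers of
  -- `u`, `sinh u` and `cosh u` with those in `exp (n f)`.
  have hpow : (((2 * (n + g) : ℕ) : ℝ) / e) ^ (2 * (n + g)) * (2 * Real.sinh u) ^ (2 * n) *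
      (e ^ n) ^ 2 * e ^ (2 * g) * Real.sinh u ^ (2 * g) =
      ((n : ℝ) ^ n) ^ 2 * (n : ℝ) ^ (2 * g) * (2 * u) ^ (2 * (n + g)) *
      (4 * Real.cosh u ^ 2) ^ n * Real.cosh u ^ (2 * g) := by
    have h1 : ((2 * (n + g) : ℕ) : ℝ) / e = 2 * u * (n * Real.cosh u / (Real.sinh u * e)) := by
      push_cast
      rw [hN]
      ring
    rw [h1, mul_pow (2 * u), div_pow, mul_pow, mul_pow (Real.sinh u)]
    rw [show (4 * Real.cosh u ^ 2) ^ n = 2 ^ (2 * n) * Real.cosh u ^ (2 * n) by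
      rw [mul_pow, ← pow_mul, pow_mul 2 2 n]; norm_num]
    rw [mul_add 2 n g, pow_add, pow_add, pow_add, pow_add, pow_add, mul_pow, mul_pow, mul_pow]
    field_simp
    ring
  have hsqn : √(2 * (n : ℝ) * Real.pi) ^ 2 = 2 * n * Real.pi := Real.sq_sqrt (by positivity)
  have hsq2 : √(2 * Real.pi) ^ 2 = 2 * Real.pi := Real.sq_sqrt (by positivity)
  have hsqg : √(2 * (g : ℝ) * Real.pi) = √(g : ℝ) * √(2 * Real.pi) := by
    rw [← Real.sqrt_mul hg0.le]
    congr 1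
    ring
  -- The prefactor of `Omega` is `1 / (2 π)` up to a Stirling ratio.
  have hblock : √(g : ℝ) * (g : ℝ) ^ g / (√(2 * Real.pi) * e ^ g * (g.factorial : ℝ)) =
      1 / (2 * Real.pi * stirlingRatio g) := by
    rw [hfg, hsqg, div_pow, show 1 / (2 * Real.pi * stirlingRatio g) =
      1 / (√(2 * Real.pi) ^ 2 * stirlingRatio g) by rw [hsq2]]
    field_simp
  have hfn2 : (n.factorial : ℝ) ^ 2 =
      stirlingRatio n ^ 2 * (2 * n * Real.pi) * (((n : ℝ) ^ n) ^ 2 / (e ^ n) ^ 2) := by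
    nth_rewrite 1 [hfn]
    rw [div_pow, mul_pow, mul_pow, hsqn, div_pow]
    ring
  have hroot' : √(2 * ((2 * (n + g) : ℕ) : ℝ) * Real.pi) =
      4 * Real.pi * √(sinhVariance n u / (2 * Real.pi)) / √(jArg u) := by
    rw [eq_div_iff (Real.sqrt_pos.mpr hD).ne', hroot, mul_assoc 2, ← sq, hsq2]
    ring
  have hpow' : (((2 * (n + g) : ℕ) : ℝ) / e) ^ (2 * (n + g)) =
      ((n : ℝ) ^ n) ^ 2 * (n : ℝ) ^ (2 * g) * (2 * u) ^ (2 * (n + g)) *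
      (4 * Real.cosh u ^ 2) ^ n * Real.cosh u ^ (2 * g) /
      ((2 * Real.sinh u) ^ (2 * n) * (e ^ n) ^ 2 * e ^ (2 * g) * Real.sinh u ^ (2 * g)) := by
    rw [eq_div_iff (by positivity), ← hpow]
    ring
  have hsD := Real.sqrt_pos.mpr hD
  have hR : 0 < √(sinhVariance n u / (2 * Real.pi)) := by
    refine Real.sqrt_pos.mpr (div_pos ?_ (by positivity))
    rw [sinhVariance_eq n hu]
    positivity
  rw [hblock, hfn2, hfN, hroot', hpow', div_pow (Real.cosh u)]
  have p1 : 0 < (n : ℝ) ^ n := by positivity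
  have p2 : 0 < (n : ℝ) ^ (2 * g) := by positivity
  have p3 : 0 < (2 * u) ^ (2 * (n + g)) := by positivity
  have p4 : 0 < (4 * Real.cosh u ^ 2) ^ n := by positivity
  have p5 : 0 < Real.cosh u ^ (2 * g) := by positivity
  have p6 : 0 < (2 * Real.sinh u) ^ (2 * n) := by positivity
  have p7 : 0 < e ^ n := by positivity
  have p8 : 0 < e ^ (2 * g) := by positivity
  have p9 : 0 < Real.sinh u ^ (2 * g) := by positivity
  generalize (n : ℝ) ^ n = x1 at *
  generalize (n : ℝ) ^ (2 * g) = x2 at *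
  generalize (2 * u) ^ (2 * (n + g)) = x3 at *
  generalize (4 * Real.cosh u ^ 2) ^ n = x4 at *
  generalize Real.cosh u ^ (2 * g) = x5 at *
  generalize (2 * Real.sinh u) ^ (2 * n) = x6 at *
  generalize e ^ n = x7 at *
  generalize e ^ (2 * g) = x8 at *
  generalize Real.sinh u ^ (2 * g) = x9 at *
  generalize √(jArg u) = x10 at *
  generalize √(sinhVariance n u / (2 * Real.pi)) = x11 at *
  generalize stirlingRatio (2 * (n + g)) = y1 at *
  generalize stirlingRatio g = y2 at *
  generalize stirlingRatio n = y3 at *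
  field_simp
  ring

theorem Omega_pos {n : ℕ} (hn : 1 ≤ n) (g : ℕ) : 0 < Omega n g := by
  have hpi := Real.pi_pos
  have hn0 : (0 : ℝ) < n := by exact_mod_cast hn
  rcases Nat.eq_zero_or_pos g with rfl | hg
  · rw [Omega, if_pos rfl]
    positivity
  · have hg0 : (0 : ℝ) < g := by exact_mod_cast hg
    rw [Omega, if_neg hg.ne']
    positivity

/-- Saddle point asymptotics, with an error term depending on `g` only. -/
theorem exists_abs_E_div_Omega_sub_le : ∃ K : ℝ, 0 ≤ K ∧ ∀ n g : ℕ, 1 ≤ n → 1 ≤ g →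
    |E n g / Omega n g - stirlingFactor n g| ≤ |stirlingFactor n g| * (K / √(g : ℝ)) := by
  have hpi := Real.pi_pos
  set K0 : ℝ := 2 * Real.exp Real.pi * Real.exp (1 / 2) * Real.pi ^ 4 / 4 + 2 with hK0
  have hK0' : 0 ≤ K0 := by positivity
  refine ⟨K0, hK0', fun n g hn hg1 => ?_⟩
  have hn0 : (0 : ℝ) < n := by exact_mod_cast hn
  have hg0 : (0 : ℝ) < g := by exact_mod_cast hg1
  obtain ⟨u, hu, hug⟩ := exists_cothTheta_eq (div_pos hg0 hn0)
  have hg : (n : ℝ) * cothTheta u = g := by rw [hug]; field_simp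
  have hVg := half_le_sinhVariance hu hg
  have hV : 0 < sinhVariance n u := by linarith
  have h1 := abs_centralFactorial_sub_le n g hu hV hg
  rw [← hK0] at h1
  rw [E_eq_mul_Omega hn hg1 hu hg, mul_div_cancel_right₀ _ (Omega_pos hn g).ne']
  set A := ((2 * n).factorial : ℝ) * centralFactorial n g * (2 * u) ^ (2 * (n + g)) /
        ((2 * (n + g)).factorial : ℝ) * (2 * Real.pi) / (2 * Real.sinh u) ^ (2 * n) with hA
  set V := sinhVariance n u with hVdef
  have h2 : √(V / (2 * Real.pi)) * √(2 * Real.pi / V) = 1 := by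
    rw [← Real.sqrt_mul (by positivity)]
    have : V / (2 * Real.pi) * (2 * Real.pi / V) = 1 := by field_simp
    rw [this, Real.sqrt_one]
  have h3 : stirlingFactor n g * (√(V / (2 * Real.pi)) * A) - stirlingFactor n g =
      stirlingFactor n g * (√(V / (2 * Real.pi)) * (A - √(2 * Real.pi / V))) := by
    rw [mul_sub (√(V / (2 * Real.pi))), h2]
    ring
  rw [h3, abs_mul, abs_mul, abs_of_nonneg (Real.sqrt_nonneg _)]
  refine mul_le_mul_of_nonneg_left ?_ (abs_nonneg _)
  calc √(V / (2 * Real.pi)) * |A - √(2 * Real.pi / V)|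
      ≤ √(V / (2 * Real.pi)) * (K0 / V) := by gcongr
    _ = K0 / √(2 * Real.pi * V) := by
      have hV1 : √(V / (2 * Real.pi)) * √(2 * Real.pi * V) = V := by
        rw [← Real.sqrt_mul (by positivity), show V / (2 * Real.pi) * (2 * Real.pi * V) = V ^ 2 by
          field_simp, Real.sqrt_sq hV.le]
      have hpos : 0 < √(2 * Real.pi * V) := Real.sqrt_pos.mpr (by positivity)
      rw [eq_div_iff hpos.ne', mul_right_comm, hV1, mul_div_cancel₀ _ hV.ne']
    -- The variance is at least `g / 2`, hence `2 π V ≥ g`.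
    _ ≤ K0 / √(g : ℝ) := by
      gcongr
      nlinarith [Real.pi_gt_three]

theorem tendsto_stirlingFactor :
    Tendsto (fun p : ℕ × ℕ => stirlingFactor p.1 p.2) (atTop ×ˢ atTop) (nhds 1) := by
  have hsum : Tendsto (fun p : ℕ × ℕ => 2 * (p.1 + p.2)) (atTop ×ˢ atTop) atTop := by
    refine tendsto_atTop_mono (fun p => ?_) tendsto_fst
    change p.1 ≤ 2 * (p.1 + p.2)
    lia
  have h1 := tendsto_stirlingRatio.comp hsum
  have h2 := tendsto_stirlingRatio.comp
    (tendsto_snd (f := (atTop : Filter ℕ)) (g := (atTop : Filter ℕ)))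
  have h3 := tendsto_stirlingRatio.comp
    (tendsto_fst (f := (atTop : Filter ℕ)) (g := (atTop : Filter ℕ)))
  have h4 := (tendsto_natCast_div_add_atTop (1 : ℝ)).comp
    (tendsto_fst (f := (atTop : Filter ℕ)) (g := (atTop : Filter ℕ)))
  have h5 := ((h1.mul h2).div (h3.pow 2) (by norm_num)).mul h4
  simpa [stirlingFactor, Function.comp_def] using h5

theorem tendsto_E_div_Omega_prod :
    Tendsto (fun p : ℕ × ℕ => E p.1 p.2 / Omega p.1 p.2) (atTop ×ˢ atTop) (nhds 1) := by
  obtain ⟨K, hK, h⟩ := exists_abs_E_div_Omega_sub_le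
  have h1 : Tendsto (fun p : ℕ × ℕ => |stirlingFactor p.1 p.2| * (K / √(p.2 : ℝ)))
      (atTop ×ˢ atTop) (nhds 0) := by
    have h2 : Tendsto (fun p : ℕ × ℕ => √(p.2 : ℝ)) (atTop ×ˢ atTop) atTop :=
      Real.tendsto_sqrt_atTop.comp (tendsto_natCast_atTop_atTop.comp tendsto_snd)
    have h3 := tendsto_stirlingFactor.abs.mul (h2.const_div_atTop K)
    simpa using h3
  have h2 : Tendsto (fun p : ℕ × ℕ => E p.1 p.2 / Omega p.1 p.2 - stirlingFactor p.1 p.2)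
      (atTop ×ˢ atTop) (nhds 0) := by
    refine squeeze_zero_norm' ?_ h1
    filter_upwards [(eventually_ge_atTop 1).prod_mk (eventually_ge_atTop 1)] with p hp
    exact h p.1 p.2 hp.1 hp.2
  simpa using h2.add tendsto_stirlingFactor

/-! ### Expansions at the origin -/

theorem tendsto_sinh_div : Tendsto (fun u : ℝ => Real.sinh u / u) (nhdsWithin 0 (Ioi 0))
    (nhds 1) := by
  have h := (Real.hasDerivAt_sinh 0).tendsto_slope_zero_right
  simp only [zero_add, Real.sinh_zero, sub_zero, smul_eq_mul, Real.cosh_zero] at h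
  exact h.congr fun u => by rw [div_eq_inv_mul]

theorem tendsto_cosh_sub_one_div : Tendsto (fun u : ℝ => (Real.cosh u - 1) / u ^ 2)
    (nhdsWithin 0 (Ioi 0)) (nhds (1 / 2)) := by
  have hhalf : Tendsto (fun u : ℝ => u / 2) (nhdsWithin 0 (Ioi 0)) (nhdsWithin 0 (Ioi 0)) := by
    refine tendsto_nhdsWithin_iff.mpr ⟨?_, ?_⟩
    · have : Continuous fun u : ℝ => u / 2 := by fun_prop
      exact (this.tendsto' 0 0 (by simp)).mono_left nhdsWithin_le_nhds
    · filter_upwards [self_mem_nhdsWithin] with u hu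
      exact mem_Ioi.mpr (half_pos (mem_Ioi.mp hu))
  have h := ((tendsto_sinh_div.comp hhalf).pow 2).div_const 2
  rw [one_pow] at h
  refine h.congr' ?_
  filter_upwards [self_mem_nhdsWithin] with u hu
  have hu : 0 < u := hu
  have h1 := Real.cosh_two_mul (u / 2)
  rw [show 2 * (u / 2) = u by ring, Real.cosh_sq] at h1
  rw [h1, Function.comp_apply]
  field_simp
  ring

theorem tendsto_sinh_sub_div : Tendsto (fun u : ℝ => (Real.sinh u - u) / u ^ 3)
    (nhdsWithin 0 (Ioi 0)) (nhds (1 / 6)) := by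
  refine HasDerivAt.lhopital_zero_nhdsGT (f' := fun u => Real.cosh u - 1)
    (g' := fun u => 3 * u ^ 2) ?_ ?_ ?_ ?_ ?_ ?_
  · exact Eventually.of_forall fun u => (Real.hasDerivAt_sinh u).sub (hasDerivAt_id u)
  · exact Eventually.of_forall fun u => by simpa using hasDerivAt_pow 3 u
  · filter_upwards [self_mem_nhdsWithin] with u hu
    have hu : 0 < u := hu
    positivity
  · have : Continuous fun u : ℝ => Real.sinh u - u := by fun_prop
    exact (this.tendsto' 0 0 (by simp)).mono_left nhdsWithin_le_nhds
  · have : Continuous fun u : ℝ => u ^ 3 := by fun_prop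
    exact (this.tendsto' 0 0 (by simp)).mono_left nhdsWithin_le_nhds
  · have h := tendsto_cosh_sub_one_div.div_const 3
    rw [show (1 : ℝ) / 2 / 3 = 1 / 6 by norm_num] at h
    refine h.congr fun u => ?_
    rw [div_div, mul_comm]

theorem tendsto_cosh_nhdsGT : Tendsto Real.cosh (nhdsWithin 0 (Ioi 0)) (nhds 1) :=
  (Real.continuous_cosh.tendsto' 0 1 Real.cosh_zero).mono_left nhdsWithin_le_nhds

theorem tendsto_cothTheta_div : Tendsto (fun u : ℝ => cothTheta u / u ^ 2)
    (nhdsWithin 0 (Ioi 0)) (nhds (1 / 3)) := by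
  have h := (tendsto_cosh_sub_one_div.sub tendsto_sinh_sub_div).div tendsto_sinh_div one_ne_zero
  rw [show ((1 : ℝ) / 2 - 1 / 6) / 1 = 1 / 3 by norm_num] at h
  refine h.congr' ?_
  filter_upwards [self_mem_nhdsWithin] with u hu
  have hu : 0 < u := hu
  have hs := Real.sinh_pos_iff.mpr hu
  rw [Pi.div_apply, cothTheta]
  field_simp
  ring

theorem tendsto_jArg_div : Tendsto (fun u : ℝ => jArg u / u ^ 2)
    (nhdsWithin 0 (Ioi 0)) (nhds (2 / 3)) := by
  have hdouble : Tendsto (fun u : ℝ => 2 * u) (nhdsWithin 0 (Ioi 0)) (nhdsWithin 0 (Ioi 0)) := by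
    refine tendsto_nhdsWithin_iff.mpr ⟨?_, ?_⟩
    · have : Continuous fun u : ℝ => 2 * u := by fun_prop
      exact (this.tendsto' 0 0 (by simp)).mono_left nhdsWithin_le_nhds
    · filter_upwards [self_mem_nhdsWithin] with u hu
      exact mem_Ioi.mpr (mul_pos two_pos (mem_Ioi.mp hu))
  have h := (((tendsto_sinh_sub_div.comp hdouble).const_mul 4).div tendsto_sinh_div
    one_ne_zero).div tendsto_cosh_nhdsGT one_ne_zero
  rw [show (4 : ℝ) * (1 / 6) / 1 / 1 = 2 / 3 by norm_num] at h
  refine h.congr' ?_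
  filter_upwards [self_mem_nhdsWithin] with u hu
  have hu : 0 < u := hu
  have hs := Real.sinh_pos_iff.mpr hu
  have hc := Real.cosh_pos u
  rw [Pi.div_apply, Pi.div_apply, Function.comp_apply, jArg, Real.sinh_two_mul]
  field_simp
  ring

theorem tendsto_log_cosh_div : Tendsto (fun u : ℝ => Real.log (Real.cosh u) / u ^ 2)
    (nhdsWithin 0 (Ioi 0)) (nhds (1 / 2)) := by
  have h1 : Tendsto (fun x : ℝ => Real.log x / (x - 1)) (nhdsWithin 1 (Ioi 1)) (nhds 1) := by
    have h := (Real.hasDerivAt_log one_ne_zero).tendsto_slope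
    rw [inv_one] at h
    refine (h.mono_left (nhdsWithin_mono _ fun x hx => (ne_of_gt hx))).congr fun x => ?_
    rw [slope_def_field, Real.log_one, sub_zero]
  have h2 : Tendsto Real.cosh (nhdsWithin 0 (Ioi 0)) (nhdsWithin 1 (Ioi 1)) := by
    refine tendsto_nhdsWithin_iff.mpr ⟨tendsto_cosh_nhdsGT, ?_⟩
    filter_upwards [self_mem_nhdsWithin] with u hu
    exact Real.one_lt_cosh.mpr (ne_of_gt hu)
  have h := (h1.comp h2).mul tendsto_cosh_sub_one_div
  rw [one_mul] at h
  refine h.congr' ?_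
  filter_upwards [self_mem_nhdsWithin] with u hu
  have hu : 0 < u := hu
  have hc : Real.cosh u - 1 ≠ 0 := (sub_pos.mpr (Real.one_lt_cosh.mpr hu.ne')).ne'
  rw [Function.comp_apply]
  field_simp

/-! ### Fixed `g` -/

theorem pow_add_mul_pow_le {x : ℝ} (hx : 0 ≤ x) (m : ℕ) :
    x ^ (m + 1) + (m + 1) * x ^ m ≤ (x + 1) ^ (m + 1) := by
  induction m with
  | zero => simp
  | succ m ih =>
    have h1 : (0 : ℝ) ≤ m * x ^ m + x ^ m := by positivity
    have h2 := mul_le_mul_of_nonneg_right ih (by linarith : 0 ≤ x + 1)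
    rw [pow_succ (x + 1) (m + 1)]
    refine le_trans ?_ h2
    push_cast
    have h3 : (x ^ (m + 1) + (m + 1) * x ^ m) * (x + 1) =
      x ^ (m + 1 + 1) + (m + 1 + 1) * x ^ (m + 1) + (m * x ^ m + x ^ m) := by ring
    rw [h3]
    linarith

theorem add_one_pow_le {x : ℝ} (hx : 0 ≤ x) (m : ℕ) :
    (x + 1) ^ (m + 1) ≤ x ^ (m + 1) + (m + 1) * (x + 1) ^ m := by
  induction m with
  | zero => simp
  | succ m ih =>
    have h1 : x ^ (m + 1) ≤ (x + 1) ^ (m + 1) := by gcongr; linarith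
    have h2 := mul_le_mul_of_nonneg_right ih (by linarith : 0 ≤ x + 1)
    rw [pow_succ (x + 1) (m + 1)]
    refine le_trans h2 ?_
    push_cast
    have h3 : (x ^ (m + 1) + (m + 1) * (x + 1) ^ m) * (x + 1) =
      x ^ (m + 1 + 1) + (m + 1) * (x + 1) ^ (m + 1) + x ^ (m + 1) := by ring
    rw [h3]
    linarith

/-- With the normalisation `3 ^ g g!` the recurrence in `n` has increments `(3 g + 3) (n + 1) ^ 2`
times the preceding case, a discrete form of differentiating `x ^ (3 g + 3)`. The two preceding
inequalities compare such increments with those of a power. -/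
theorem centralFactorial_bounds (g n : ℕ) :
    (n : ℝ) ^ (3 * g) ≤ 3 ^ g * (g.factorial : ℝ) * centralFactorial n g ∧
      3 ^ g * (g.factorial : ℝ) * centralFactorial n g ≤ ((n : ℝ) + g) ^ (3 * g) := by
  induction g generalizing n with
  | zero => simp
  | succ g ihg =>
    have hm : 3 * (g + 1) = (3 * g + 2) + 1 := by ring
    induction n with
    | zero =>
      rw [centralFactorial_zero_left]
      simp only [Nat.cast_zero, mul_zero, zero_add]
      exact ⟨by rw [hm, zero_pow (by lia)], by positivity⟩
    | succ n ihn =>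
      obtain ⟨l1, l2⟩ := ihg (n + 1)
      obtain ⟨k1, k2⟩ := ihn
      have hn : (0 : ℝ) ≤ n := n.cast_nonneg
      have hg : (0 : ℝ) ≤ g := g.cast_nonneg
      have hrec : 3 ^ (g + 1) * ((g + 1).factorial : ℝ) * centralFactorial (n + 1) (g + 1) =
          3 ^ (g + 1) * ((g + 1).factorial : ℝ) * centralFactorial n (g + 1) +
          (3 * g + 2 + 1) * ((n : ℝ) + 1) ^ 2 *
            (3 ^ g * (g.factorial : ℝ) * centralFactorial (n + 1) g) := by
        rw [centralFactorial_succ_succ, Nat.factorial_succ]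
        push_cast
        ring
      rw [hrec]
      push_cast at l1 l2 k1 k2 ⊢
      rw [hm] at k1 k2 ⊢
      constructor
      · have h1 := add_one_pow_le hn (3 * g + 2)
        push_cast at h1
        have h2 : (3 * (g : ℝ) + 2 + 1) * ((n : ℝ) + 1) ^ (3 * g + 2) ≤
            (3 * g + 2 + 1) * ((n : ℝ) + 1) ^ 2 *
              (3 ^ g * (g.factorial : ℝ) * centralFactorial (n + 1) g) := by
          rw [pow_add, mul_comm (((n : ℝ) + 1) ^ (3 * g)), ← mul_assoc]
          gcongr
        linarith
      · have h1 := pow_add_mul_pow_le (x := (n : ℝ) + (g + 1)) (by positivity) (3 * g + 2)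
        push_cast at h1
        have h2 : (3 * g + 2 + 1) * ((n : ℝ) + 1) ^ 2 *
              (3 ^ g * (g.factorial : ℝ) * centralFactorial (n + 1) g) ≤
            (3 * (g : ℝ) + 2 + 1) * ((n : ℝ) + (g + 1)) ^ (3 * g + 2) := by
          rw [show (n : ℝ) + 1 + g = n + (g + 1) by ring] at l2
          rw [show (3 * (g : ℝ) + 2 + 1) * ((n : ℝ) + (g + 1)) ^ (3 * g + 2) =
            (3 * g + 2 + 1) * (n + (g + 1)) ^ 2 * (n + (g + 1)) ^ (3 * g) by ring]
          refine mul_le_mul ?_ l2 ?_ (by positivity)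
          · gcongr
            linarith
          · exact le_trans (by positivity) l1
        have h3 : (n : ℝ) + 1 + (g + 1) = n + (g + 1) + 1 := by ring
        rw [h3]
        linarith

theorem rpow_neg_three_halves {x : ℝ} (hx : 0 < x) : x ^ (-(3 / 2) : ℝ) = √x / x ^ 2 := by
  rw [show (-(3 / 2) : ℝ) = 1 / 2 - (2 : ℕ) by norm_num, Real.rpow_sub hx, Real.rpow_natCast,
    Real.sqrt_eq_rpow]

theorem E_zero_div_Omega_zero {n : ℕ} (hn : 1 ≤ n) : E n 0 / Omega n 0 =
    stirlingRatio (2 * n) / stirlingRatio n ^ 2 * (n / (n + 1)) := by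
  have hn0 : (0 : ℝ) < n := by exact_mod_cast hn
  have hpi := Real.pi_pos
  have hs := stirlingRatio_pos hn
  rw [E_eq hn, centralFactorial_zero_right, centralBinom_eq_div,
    factorial_eq_stirlingRatio_mul (show 1 ≤ 2 * n by lia), factorial_eq_stirlingRatio_mul hn,
    Omega, if_pos rfl, rpow_neg_three_halves hn0]
  have h1 : √(2 * ((2 * n : ℕ) : ℝ) * Real.pi) = 2 * (√(n : ℝ) * √Real.pi) := by
    rw [← Real.sqrt_mul hn0.le, show 2 * ((2 * n : ℕ) : ℝ) * Real.pi = 2 ^ 2 * (n * Real.pi) by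
      push_cast; ring, Real.sqrt_mul (by norm_num), Real.sqrt_sq (by norm_num)]
  have h2 : √(2 * (n : ℝ) * Real.pi) ^ 2 = 2 * n * Real.pi := Real.sq_sqrt (by positivity)
  have h3 : (((2 * n : ℕ) : ℝ) / Real.exp 1) ^ (2 * n) =
      4 ^ n * ((n / Real.exp 1) ^ n) ^ 2 := by
    rw [Nat.cast_mul, Nat.cast_ofNat, mul_div_assoc, mul_pow, pow_mul, ← pow_mul _ n 2,
      mul_comm n 2]
    norm_num
  have h4 : √Real.pi ^ 2 = Real.pi := Real.sq_sqrt hpi.le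
  rw [mul_pow (stirlingRatio n), mul_pow √(2 * (n : ℝ) * Real.pi), h1, h2, h3]
  have h5 : 0 < ((n : ℝ) / Real.exp 1) ^ n := by positivity
  generalize ((n : ℝ) / Real.exp 1) ^ n = x at *
  field_simp
  rw [h4]

theorem tendsto_E_zero_div_Omega_zero :
    Tendsto (fun n : ℕ => E n 0 / Omega n 0) atTop (nhds 1) := by
  have h1 := tendsto_stirlingRatio.comp (tendsto_id.const_mul_atTop' (show 0 < 2 by norm_num))
  have h := (h1.div (tendsto_stirlingRatio.pow 2) (by norm_num)).mul
    (tendsto_natCast_div_add_atTop (1 : ℝ))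
  rw [one_pow, div_one, one_mul] at h
  refine h.congr' ?_
  filter_upwards [eventually_ge_atTop 1] with n hn
  exact (E_zero_div_Omega_zero hn).symm

theorem tendsto_centralFactorial_div (g : ℕ) :
    Tendsto (fun n : ℕ => 3 ^ g * (g.factorial : ℝ) * centralFactorial n g / (n : ℝ) ^ (3 * g))
      atTop (nhds 1) := by
  have h : Tendsto (fun n : ℕ => (((n : ℝ) + g) / n) ^ (3 * g)) atTop (nhds 1) := by
    have h1 : Tendsto (fun n : ℕ => 1 + (g : ℝ) / n) atTop (nhds (1 + 0)) :=
      tendsto_const_nhds.add (tendsto_const_div_atTop_nhds_zero_nat _)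
    have h2 := h1.pow (3 * g)
    rw [add_zero, one_pow] at h2
    refine h2.congr' ?_
    filter_upwards [eventually_ge_atTop 1] with n hn
    have hn0 : (0 : ℝ) < n := by exact_mod_cast hn
    rw [add_div, div_self hn0.ne']
  refine tendsto_of_tendsto_of_tendsto_of_le_of_le' tendsto_const_nhds h ?_ ?_
  · filter_upwards [eventually_ge_atTop 1] with n hn
    have hn0 : (0 : ℝ) < n := by exact_mod_cast hn
    rw [one_le_div (by positivity)]
    exact (centralFactorial_bounds g n).1
  · filter_upwards [eventually_ge_atTop 1] with n hn
    have hn0 : (0 : ℝ) < n := by exact_mod_cast hn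
    rw [div_pow]
    gcongr
    exact (centralFactorial_bounds g n).2

/-- The quotient is arranged so that every factor tends to `1` separately once `n u² → 3 g`. -/
theorem E_div_Omega_eq {n g : ℕ} (hn : 1 ≤ n) (hg1 : 1 ≤ g) {u : ℝ} (hu : 0 < u)
    (hg : (n : ℝ) * cothTheta u = g) :
    E n g / Omega n g = E n 0 / Omega n 0 *
      (3 ^ g * (g.factorial : ℝ) * centralFactorial n g / (n : ℝ) ^ (3 * g)) *
      (√(n * jArg u) / √(2 * g) * ((n * u ^ 2) / (3 * g)) ^ g *
        (Real.sinh u / u / Real.cosh u) ^ (2 * g) *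
        (Real.exp (3 * g) / Real.exp (2 * (n * Real.log (Real.cosh u))))) := by
  have hn0 : (0 : ℝ) < n := by exact_mod_cast hn
  have hg0 : (0 : ℝ) < g := by exact_mod_cast hg1
  have hpi := Real.pi_pos
  have hs := Real.sinh_pos_iff.mpr hu
  have hc := Real.cosh_pos u
  have hj := Real.sqrt_pos.mpr (jArg_pos hu)
  have he : Real.exp (3 * g) = Real.exp 1 ^ g * Real.exp 1 ^ (2 * g) := by
    rw [← pow_add, ← Real.exp_nat_mul]
    congr 1
    push_cast
    ring
  have hcosh : Real.exp (2 * (n * Real.log (Real.cosh u))) = Real.cosh u ^ (2 * n) := by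
    rw [← mul_assoc, mul_comm, Real.exp_mul, Real.exp_log hc]
    exact_mod_cast Real.rpow_natCast (Real.cosh u) (2 * n)
  have h4 : (4 * Real.cosh u ^ 2) ^ n = 4 ^ n * Real.cosh u ^ (2 * n) := by
    rw [mul_pow, ← pow_mul]
  have h2 : √2 ^ 2 = 2 := Real.sq_sqrt (by norm_num)
  rw [E_eq hn, E_eq hn, centralFactorial_zero_right, Omega_eq hn hg1 hu hg, he, hcosh, h4, Omega,
    if_pos rfl, rpow_neg_three_halves hn0, Real.sqrt_mul hn0.le, Real.sqrt_mul (by norm_num),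
    Real.sqrt_mul (by norm_num)]
  rw [div_pow, div_pow, div_pow, div_pow, mul_pow, mul_pow 3 (g : ℝ), ← pow_mul u,
    show 3 * g = g + 2 * g by ring, pow_add (n : ℝ)]
  have p1 : 0 < (n : ℝ) ^ g := by positivity
  have p2 : 0 < (n : ℝ) ^ (2 * g) := by positivity
  have p3 : 0 < u ^ (2 * g) := by positivity
  have p4 : 0 < Real.cosh u ^ (2 * n) := by positivity
  have p5 : 0 < Real.cosh u ^ (2 * g) := by positivity
  have p6 : 0 < Real.sinh u ^ (2 * g) := by positivity
  have p7 : 0 < Real.exp 1 ^ g := by positivity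
  have p8 : 0 < Real.exp 1 ^ (2 * g) := by positivity
  have p9 : 0 < (g : ℝ) ^ g := by positivity
  have p10 : (0 : ℝ) < 4 ^ n := by positivity
  have p11 : (0 : ℝ) < 3 ^ g := by positivity
  have p12 : (0 : ℝ) < g.factorial := by positivity
  generalize (n : ℝ) ^ g = x1 at *
  generalize (n : ℝ) ^ (2 * g) = x2 at *
  generalize u ^ (2 * g) = x3 at *
  generalize Real.cosh u ^ (2 * n) = x4 at *
  generalize Real.cosh u ^ (2 * g) = x5 at *
  generalize Real.sinh u ^ (2 * g) = x6 at *
  generalize Real.exp 1 ^ g = x7 at *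
  generalize Real.exp 1 ^ (2 * g) = x8 at *
  generalize (g : ℝ) ^ g = x9 at *
  generalize (4 : ℝ) ^ n = x10 at *
  generalize (3 : ℝ) ^ g = x11 at *
  generalize (g.factorial : ℝ) = x12 at *
  generalize √(jArg u) = x13 at *
  generalize centralFactorial n g = x14 at *
  field_simp
  rw [h2]

theorem exists_tendsto_cothTheta_eq {g : ℕ} (hg : 1 ≤ g) : ∃ u : ℕ → ℝ,
    (∀ n, 1 ≤ n → 0 < u n ∧ (n : ℝ) * cothTheta (u n) = g) ∧
      Tendsto u atTop (nhdsWithin 0 (Ioi 0)) := by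
  have hg0 : (0 : ℝ) < g := by exact_mod_cast hg
  have h (n : ℕ) : ∃ u : ℝ, 1 ≤ n → 0 < u ∧ cothTheta u = g / n := by
    by_cases hn : 1 ≤ n
    · obtain ⟨u, hu⟩ := exists_cothTheta_eq (y := (g : ℝ) / n)
        (div_pos hg0 (by exact_mod_cast hn))
      exact ⟨u, fun _ => hu⟩
    · exact ⟨0, fun h => absurd h hn⟩
  choose u hu using h
  refine ⟨u, fun n hn => ⟨(hu n hn).1, ?_⟩, ?_⟩
  · have hn0 : (0 : ℝ) < n := by exact_mod_cast hn
    rw [(hu n hn).2]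
    field_simp
  · have hpos : ∀ᶠ n in atTop, u n ∈ Ioi (0 : ℝ) := by
      filter_upwards [eventually_ge_atTop 1] with n hn
      exact (hu n hn).1
    refine tendsto_nhdsWithin_iff.mpr ⟨?_, hpos⟩
    rw [Metric.tendsto_nhds]
    intro δ hδ
    filter_upwards [eventually_ge_atTop 1, (tendsto_const_div_atTop_nhds_zero_nat
      (g : ℝ)).eventually_lt_const (cothTheta_pos hδ)] with n hn hlt
    rw [← (hu n hn).2] at hlt
    have hlt' := (strictMonoOn_cothTheta.lt_iff_lt (mem_Ioi.mpr (hu n hn).1)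
      (mem_Ioi.mpr hδ)).mp hlt
    rw [Real.dist_eq, sub_zero, abs_of_pos (hu n hn).1]
    exact hlt'

/-- For fixed `g` the saddle point tends to the origin. -/
theorem tendsto_E_div_Omega_of_pos {g : ℕ} (hg1 : 1 ≤ g) :
    Tendsto (fun n : ℕ => E n g / Omega n g) atTop (nhds 1) := by
  have hg0 : (0 : ℝ) < g := by exact_mod_cast hg1
  obtain ⟨u, hu, hlim⟩ := exists_tendsto_cothTheta_eq hg1
  -- Near the origin `cothTheta u ~ u² / 3`, while `n cothTheta u = g`.
  have hsq : Tendsto (fun n : ℕ => (n : ℝ) * u n ^ 2) atTop (nhds (3 * g)) := by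
    have h := (tendsto_const_nhds (x := (g : ℝ))).div (tendsto_cothTheta_div.comp hlim)
      (by norm_num)
    rw [show (g : ℝ) / (1 / 3) = 3 * g by ring] at h
    refine h.congr' ?_
    filter_upwards [eventually_ge_atTop 1] with n hn
    obtain ⟨h1, h2⟩ := hu n hn
    have h3 := cothTheta_pos h1
    rw [Pi.div_apply, Function.comp_apply, ← h2]
    field_simp
  have hmul {F : ℝ → ℝ} {c : ℝ} (hF : Tendsto (fun u => F u / u ^ 2) (nhdsWithin 0 (Ioi 0))
      (nhds c)) : Tendsto (fun n : ℕ => (n : ℝ) * F (u n)) atTop (nhds (3 * g * c)) := by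
    refine (hsq.mul (hF.comp hlim)).congr' ?_
    filter_upwards [eventually_ge_atTop 1] with n hn
    have h1 := (hu n hn).1
    rw [Function.comp_apply]
    field_simp
  have l1 : Tendsto (fun n : ℕ => √(n * jArg (u n)) / √(2 * g)) atTop (nhds 1) := by
    have h := (hmul tendsto_jArg_div).sqrt.div_const √(2 * (g : ℝ))
    rwa [show 3 * (g : ℝ) * (2 / 3) = 2 * g by ring,
      div_self (Real.sqrt_pos.mpr (by positivity)).ne'] at h
  have l2 : Tendsto (fun n : ℕ => ((n * u n ^ 2) / (3 * (g : ℝ))) ^ g) atTop (nhds 1) := by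
    have h := (hsq.div_const (3 * (g : ℝ))).pow g
    rwa [div_self (by positivity), one_pow] at h
  have l3 : Tendsto (fun n : ℕ => (Real.sinh (u n) / u n / Real.cosh (u n)) ^ (2 * g)) atTop
      (nhds 1) := by
    have h := ((tendsto_sinh_div.comp hlim).div (tendsto_cosh_nhdsGT.comp hlim)
      one_ne_zero).pow (2 * g)
    rwa [div_one, one_pow] at h
  have l4 : Tendsto (fun n : ℕ => Real.exp (3 * g) /
      Real.exp (2 * (n * Real.log (Real.cosh (u n))))) atTop (nhds 1) := by
    have h := (tendsto_const_nhds (x := Real.exp (3 * g))).div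
      ((Real.continuous_exp.tendsto _).comp ((hmul tendsto_log_cosh_div).const_mul 2))
      (Real.exp_pos _).ne'
    rwa [show 2 * (3 * (g : ℝ) * (1 / 2)) = 3 * g by ring, div_self (Real.exp_pos _).ne'] at h
  have h := (tendsto_E_zero_div_Omega_zero.mul (tendsto_centralFactorial_div g)).mul
    (((l1.mul l2).mul l3).mul l4)
  simp only [mul_one] at h
  refine h.congr' ?_
  filter_upwards [eventually_ge_atTop 1] with n hn
  exact (E_div_Omega_eq hn hg1 (hu n hn).1 (hu n hn).2).symm

theorem tendsto_E_div_Omega (g : ℕ) :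
    Tendsto (fun n : ℕ => E n g / Omega n g) atTop (nhds 1) := by
  rcases Nat.eq_zero_or_pos g with rfl | hg
  · exact tendsto_E_zero_div_Omega_zero
  · exact tendsto_E_div_Omega_of_pos hg

/-! ### Uniformity in `g` -/

theorem tendstoUniformly_E_div_Omega :
    TendstoUniformly (fun n g : ℕ => E n g / Omega n g) (fun _ : ℕ => (1 : ℝ)) atTop := by
  rw [Metric.tendstoUniformly_iff]
  intro ε hε
  have h1 : ∀ᶠ p : ℕ × ℕ in atTop ×ˢ atTop, dist 1 (E p.1 p.2 / Omega p.1 p.2) < ε := by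
    filter_upwards [Metric.tendsto_nhds.mp tendsto_E_div_Omega_prod ε hε] with p hp
    rwa [dist_comm]
  rw [prod_atTop_atTop_eq, eventually_atTop] at h1
  obtain ⟨⟨N, G⟩, h1⟩ := h1
  -- The joint limit leaves only the finitely many `g < G`, where pointwise convergence suffices.
  have h2 : ∀ᶠ n in atTop, ∀ g ∈ Set.Iio G, dist 1 (E n g / Omega n g) < ε := by
    rw [eventually_all_finite (Set.finite_Iio G)]
    intro g _
    filter_upwards [Metric.tendsto_nhds.mp (tendsto_E_div_Omega g) ε hε] with n hn
    rwa [dist_comm]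
  filter_upwards [h2, eventually_ge_atTop N] with n hn hN g
  rcases lt_or_ge g G with hg | hg
  · exact hn g hg
  · exact h1 (n, g) ⟨hN, hg⟩

theorem isEquivalent_E_Omega (g : ℕ → ℕ) :
    (fun n : ℕ => E n (g n)) ~[atTop] (fun n : ℕ => Omega n (g n)) := by
  refine (isEquivalent_iff_tendsto_one ?_).mpr ?_
  · filter_upwards [eventually_ge_atTop 1] with n hn
    exact (Omega_pos hn _).ne'
  · rw [Metric.tendsto_nhds]
    intro ε hε
    filter_upwards [Metric.tendstoUniformly_iff.mp tendstoUniformly_E_div_Omega ε hε] with n hn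
    rw [dist_comm]
    exact hn (g n)

end MonotoneHurwitz

end

/-- The function `θ` is a bijection from `(0, 1/4]` onto `[0, ∞)`, so that its inverse `λ` is
defined on `[0, ∞)`; the logarithm that defines `j` has a positive argument; and `E(n, g)` is
asymptotic to `Ω(n, g)` as `n → ∞`, along every sequence `g = g_n` and uniformly in `g`. -/
theorem theorem1 :
    Set.BijOn MonotoneHurwitz.theta (Set.Ioc 0 (1 / 4)) (Set.Ici 0) ∧
    (∀ t : ℝ, 0 < t → 0 < 1 - 4 * (t + 1) * MonotoneHurwitz.lam t) ∧
    (∀ g : ℕ → ℕ,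
      (fun n : ℕ => MonotoneHurwitz.E n (g n)) ~[atTop]
        (fun n : ℕ => MonotoneHurwitz.Omega n (g n))) ∧
    TendstoUniformly
      (fun n g : ℕ => MonotoneHurwitz.E n g / MonotoneHurwitz.Omega n g)
      (fun _ : ℕ => (1 : ℝ)) atTop :=
  ⟨MonotoneHurwitz.bijOn_theta, fun _ ht => MonotoneHurwitz.one_sub_pos ht,
    MonotoneHurwitz.isEquivalent_E_Omega, MonotoneHurwitz.tendstoUniformly_E_div_Omega⟩
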